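/- Let $K$ be an algebraically closed field and let $C$ be a basic $K$-coalgebra, i.e. the socle $C_0$ of $C$ (as a right comodule over itself) is a direct sum $C_0=\bigoplus_{i\in I_C}S_i$ of pairwise non-isomorphic simple right $C$-comodules $S_i$. The length vector of a finite dimensional right $C$-comodule $M$ is $\underline{\mathrm{length}}\,M=(m_i)_{i\in I_C}\in\mathbb Z^{(I_C)}\cong K_0(C)$, where $m_i$ is the number of composition factors of $M$ isomorphic to $S_i$. Given $v\in K_0(C)$, the coalgebra $C$ satisfies the tameness condition for $v$ if there are finitely many $K[t]$-$C$-bimodules $L^{(1)},\dots,L^{(r)}$ (right $C$-comodules $L$ with a $K[t]$-module structure extending the $K$-vector space structure, such that $\rho_L(p\cdot x)=p\cdot\rho_L(x)$), each finitely generated and free over $K[t]$, such that, up to isomorphism, all but finitely many indecomposable right $C$-comodules $M$ with $\underline{\mathrm{length}}\,M=v$ are of the form $M\cong K^1_\lambda\otimes_{K[t]}L^{(s)}$ with $1\le s\le r$, $\lambda\in K$ and $K^1_\lambda=K[t]/(t-\lambda)$. In that case $\mu^1_C(v)$ denotes the minimal possible number $r$. Let $e\in C^*=\mathrm{Hom}_K(C,K)$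 be an idempotent for the convolution product. For $x$ in a right $C$-comodule put $ex=\sum x_{(0)}e(x_{(1)})$, and for $c\in C$ put $ce=\sum e(c_{(1)})c_{(2)}$. The space $eCe$ is a coalgebra with $\Delta(exe)=\sum ex_{(1)}e\otimes ex_{(2)}e$ and counit the restriction of that of $C$. For a right $C$-comodule $M$, $eM$ is a right $eCe$-comodule with structure map $ex\mapsto\sum ex_{(0)}\otimes ex_{(1)}e$. Let $I_e=\{i\in I_C : eS_i=S_i\}$. The comodules $eS_i$, $i\in I_e$, represent the simple right $eCe$-comodules; length vectors, the tameness condition and $\mu^1_{eCe}$ for $eCe$ are taken with respect to them, so that $K_0(eCe)\cong\mathbb Z^{(I_e)}$. Let $S(N)=N\,\square_{eCe}\,Ce$ be the section functor, from right $eCe$-comodules to right $C$-comodules. Let $v=(v_i)_{i\in I_e}\in K_0(eCe)$ be such that $S(eS_i)\cong S_i$ as right $C$-comodules for all $i\in I_e$ with $v_i\neq 0$, and let $\overline v\in K_0(C)$ be given by $\overline v_i=v_i$ for $i\in I_e$ and $\overline v_i=0$ for $i\in I_C\setminus I_e$. If $C$ satisfies the tameness condition for $\overline v$, then $eCe$ satisfies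 the tameness condition for $v$, and $\mu^1_{eCe}(v)\le\mu^1_C(\overline v)$. -/

import Mathlib

open scoped TensorProduct Polynomial
open Coalgebra

universe u

/-! ### Right comodules, subcomodules and quotients -/

/-- A right comodule over a `K`-coalgebra `C`: a `K`-vector space with a coassociative and
counital structure map `ρ : M → M ⊗ C`. -/
structure RightComodule (K C : Type u) [Field K] [AddCommGroup C] [Module K C]
    [Coalgebra K C] where
  carrier : Type u
  [addCommGroup : AddCommGroup carrier]
  [module : Module K carrier]
  coact : carrier →ₗ[K] carrier ⊗[K] C
  coassoc : (TensorProduct.assoc K carrier C C).toLinearMap ∘ₗ coact.rTensor C ∘ₗ coact =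
    (comul (R := K) (A := C)).lTensor carrier ∘ₗ coact
  lTensor_counit_comp_coact :
    (counit (R := K) (A := C)).lTensor carrier ∘ₗ coact = (TensorProduct.mk K carrier K).flip 1

attribute [instance] RightComodule.addCommGroup RightComodule.module

namespace RightComodule

section Basic

variable {K : Type u} [Field K]

theorem rTensor_subtype_injective {C V : Type u} [AddCommGroup C] [Module K C]
    [AddCommGroup V] [Module K V] (p : Submodule K V) :
    Function.Injective (p.subtype.rTensor C) :=
  Module.Flat.rTensor_preserves_injective_linearMap _ p.injective_subtype

theorem rTensor_lTensor_comm {V W A B : Type u} [AddCommGroup V] [Module K V]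
    [AddCommGroup W] [Module K W] [AddCommGroup A] [Module K A] [AddCommGroup B] [Module K B]
    (f : V →ₗ[K] W) (g : A →ₗ[K] B) (t : V ⊗[K] A) :
    f.rTensor B (g.lTensor V t) = g.lTensor W (f.rTensor A t) := by
  rw [← LinearMap.comp_apply, ← LinearMap.comp_apply, LinearMap.rTensor_comp_lTensor,
    LinearMap.lTensor_comp_rTensor]

theorem assoc_rTensor_rTensor {C V W : Type u} [AddCommGroup C] [Module K C]
    [AddCommGroup V] [Module K V] [AddCommGroup W] [Module K W]
    (f : V →ₗ[K] W) (t : (V ⊗[K] C) ⊗[K] C) :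
    TensorProduct.assoc K W C C ((f.rTensor C).rTensor C t) =
      f.rTensor (C ⊗[K] C) (TensorProduct.assoc K V C C t) := by
  have : (TensorProduct.assoc K W C C).toLinearMap ∘ₗ (f.rTensor C).rTensor C =
      f.rTensor (C ⊗[K] C) ∘ₗ (TensorProduct.assoc K V C C).toLinearMap := by
    ext; simp
  exact LinearMap.congr_fun this t

variable {C : Type u} [AddCommGroup C] [Module K C] [Coalgebra K C]

/-- The `K`-linear map `f` is a morphism of right comodules. -/
def IsHom (M N : RightComodule K C) (f : M.carrier →ₗ[K] N.carrier) : Prop :=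
  f.rTensor C ∘ₗ M.coact = N.coact ∘ₗ f

/-- Isomorphism of right comodules. -/
def Iso (M N : RightComodule K C) : Prop :=
  ∃ f : M.carrier ≃ₗ[K] N.carrier, IsHom M N f.toLinearMap

/-- A subspace `p ⊆ M` is a subcomodule if `ρ(p)` lies in (the image of) `p ⊗ C`. -/
def IsSub (M : RightComodule K C) (p : Submodule K M.carrier) : Prop :=
  ∀ x ∈ p, M.coact x ∈ LinearMap.range (p.subtype.rTensor C)

/-- The restriction of the structure map to a subcomodule. -/
noncomputable def subCoact (M : RightComodule K C) (p : Submodule K M.carrier)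
    (hp : M.IsSub p) : p →ₗ[K] p ⊗[K] C :=
  (LinearEquiv.ofInjective (p.subtype.rTensor C)
      (rTensor_subtype_injective p)).symm.toLinearMap ∘ₗ
    (M.coact ∘ₗ p.subtype).codRestrict _ (fun x => hp x x.2)

theorem rTensor_subCoact (M : RightComodule K C) (p : Submodule K M.carrier)
    (hp : M.IsSub p) : p.subtype.rTensor C ∘ₗ M.subCoact p hp = M.coact ∘ₗ p.subtype := by
  ext x
  have := LinearEquiv.apply_symm_apply (LinearEquiv.ofInjective (p.subtype.rTensor C)
      (rTensor_subtype_injective p)) ((M.coact ∘ₗ p.subtype).codRestrict _ (fun x => hp x x.2) x)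
  exact congrArg Subtype.val this

theorem coassoc_apply (M : RightComodule K C) (x : M.carrier) :
    TensorProduct.assoc K M.carrier C C (M.coact.rTensor C (M.coact x)) =
      (comul (R := K) (A := C)).lTensor M.carrier (M.coact x) :=
  LinearMap.congr_fun M.coassoc x

theorem counit_apply (M : RightComodule K C) (x : M.carrier) :
    (counit (R := K) (A := C)).lTensor M.carrier (M.coact x) = x ⊗ₜ 1 :=
  LinearMap.congr_fun M.lTensor_counit_comp_coact x

/-- A subcomodule as a comodule. -/
noncomputable def sub (M : RightComodule K C) (p : Submodule K M.carrier)
    (hp : M.IsSub p) : RightComodule K C where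
  carrier := p
  coact := M.subCoact p hp
  coassoc := by
    ext x
    have hr := fun y => LinearMap.congr_fun (M.rTensor_subCoact p hp) y
    simp only [LinearMap.comp_apply, Submodule.subtype_apply] at hr
    apply rTensor_subtype_injective (C := C ⊗[K] C) p
    simp only [LinearMap.comp_apply, LinearEquiv.coe_coe]
    rw [← assoc_rTensor_rTensor, ← LinearMap.rTensor_comp_apply, M.rTensor_subCoact p hp,
      LinearMap.rTensor_comp_apply, hr, coassoc_apply, rTensor_lTensor_comm, hr]
  lTensor_counit_comp_coact := by
    ext x
    have hr := fun y => LinearMap.congr_fun (M.rTensor_subCoact p hp) y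
    simp only [LinearMap.comp_apply, Submodule.subtype_apply] at hr
    apply rTensor_subtype_injective (C := K) p
    simp only [LinearMap.comp_apply]
    rw [rTensor_lTensor_comm, hr, counit_apply]
    simp

theorem rTensor_mkQ_coact (M : RightComodule K C) (p : Submodule K M.carrier)
    (hp : M.IsSub p) : p ≤ LinearMap.ker (p.mkQ.rTensor C ∘ₗ M.coact) := by
  intro x hx
  obtain ⟨t, ht⟩ := hp x hx
  rw [LinearMap.mem_ker, LinearMap.comp_apply, ← ht, ← LinearMap.rTensor_comp_apply]
  have : p.mkQ ∘ₗ p.subtype = 0 := by ext; simp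
  rw [this]; simp

/-- The quotient of a comodule by a subcomodule. -/
noncomputable def quot (M : RightComodule K C) (p : Submodule K M.carrier)
    (hp : M.IsSub p) : RightComodule K C where
  carrier := M.carrier ⧸ p
  coact := p.liftQ (p.mkQ.rTensor C ∘ₗ M.coact) (M.rTensor_mkQ_coact p hp)
  coassoc := by
    apply Submodule.linearMap_qext
    ext x
    simp only [LinearMap.comp_apply, LinearEquiv.coe_coe, Submodule.mkQ_apply,
      Submodule.liftQ_apply]
    rw [← LinearMap.rTensor_comp_apply, Submodule.liftQ_mkQ, LinearMap.rTensor_comp_apply,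
      assoc_rTensor_rTensor, coassoc_apply, rTensor_lTensor_comm]
  lTensor_counit_comp_coact := by
    apply Submodule.linearMap_qext
    ext x
    simp only [LinearMap.comp_apply, Submodule.mkQ_apply, Submodule.liftQ_apply]
    rw [← rTensor_lTensor_comm, counit_apply]
    simp

/-- A simple comodule: nonzero, with no subcomodules besides `0` and itself. -/
def IsSimple (M : RightComodule K C) : Prop :=
  Nontrivial M.carrier ∧ ∀ p, M.IsSub p → p = ⊥ ∨ p = ⊤

/-- An indecomposable comodule: nonzero, and not a direct sum of two nonzero subcomodules. -/
def IsIndecomposable (M : RightComodule K C) : Prop :=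
  Nontrivial M.carrier ∧ ∀ p q, M.IsSub p → M.IsSub q → IsCompl p q → p = ⊥ ∨ q = ⊥

/-- The inclusion of a subcomodule. -/
noncomputable def subIncl (M : RightComodule K C) (p : Submodule K M.carrier) (hp : M.IsSub p) :
    (M.sub p hp).carrier →ₗ[K] M.carrier := p.subtype

theorem subIncl_isHom (M : RightComodule K C) (p : Submodule K M.carrier) (hp : M.IsSub p) :
    IsHom (M.sub p hp) M (M.subIncl p hp) := M.rTensor_subCoact p hp

theorem isSub_comap (M : RightComodule K C) (p q : Submodule K M.carrier)
    (hp : M.IsSub p) (hq : M.IsSub q) (hpq : p ≤ q) :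
    (M.sub q hq).IsSub (p.comap (M.subIncl q hq)) := by
  intro x hx
  obtain ⟨t, ht⟩ := hp _ hx
  let i : p →ₗ[K] (M.sub q hq).carrier := Submodule.inclusion hpq
  let j : p →ₗ[K] (p.comap (M.subIncl q hq)) := i.codRestrict _ (fun y => y.2)
  refine ⟨j.rTensor C t, ?_⟩
  apply rTensor_subtype_injective (C := C) q
  have h1 : M.subIncl q hq ∘ₗ (p.comap (M.subIncl q hq)).subtype ∘ₗ j = p.subtype := by
    ext; rfl
  have h2 := LinearMap.congr_fun (M.subIncl_isHom q hq) x
  refine Eq.trans ?_ h2.symm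
  refine Eq.trans ?_ ht
  rw [← h1, LinearMap.rTensor_comp_apply, LinearMap.rTensor_comp_apply]
  rfl

/-- The subquotient comodule `q / p` of `M`, for subcomodules `p ⊆ q ⊆ M`. -/
noncomputable def subquot (M : RightComodule K C) (p q : Submodule K M.carrier)
    (hp : M.IsSub p) (hq : M.IsSub q) (hpq : p ≤ q) : RightComodule K C :=
  (M.sub q hq).quot (p.comap (M.subIncl q hq)) (M.isSub_comap p q hp hq hpq)

/-- A composition series `0 = F 0 ⊂ F 1 ⊂ ⋯ ⊂ F n = M` by subcomodules, with simple factors. -/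
structure CompSeries (M : RightComodule K C) where
  n : ℕ
  F : Fin (n + 1) → Submodule K M.carrier
  isSub : ∀ j, M.IsSub (F j)
  zero : F 0 = ⊥
  last : F (Fin.last n) = ⊤
  le : ∀ j : Fin n, F j.castSucc ≤ F j.succ
  simple : ∀ j : Fin n,
    (M.subquot (F j.castSucc) (F j.succ) (isSub _) (isSub _) (le j)).IsSimple

/-- The `j`-th composition factor of a composition series. -/
noncomputable def CompSeries.factor {M : RightComodule K C} (s : M.CompSeries) (j : Fin s.n) :
    RightComodule K C :=
  M.subquot (s.F j.castSucc) (s.F j.succ) (s.isSub _) (s.isSub _) (s.le j)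

/-- `M` is finite dimensional and its length vector with respect to the family `S` of simple
comodules is `v`: the number of composition factors of `M` isomorphic to `S i` is `v i`. -/
def HasLengthVector {I : Type*} (S : I → RightComodule K C) (M : RightComodule K C)
    (v : I →₀ ℤ) : Prop :=
  FiniteDimensional K M.carrier ∧
    ∃ s : M.CompSeries, ∀ i, v i = (Nat.card {j : Fin s.n // (s.factor j).Iso (S i)} : ℤ)

variable (K C) in
/-- `C` as a right comodule over itself. -/
noncomputable abbrev regular : RightComodule K C where
  carrier := C
  coact := comul
  coassoc := Coalgebra.coassoc
  lTensor_counit_comp_coact := Coalgebra.lTensor_counit_comp_comul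

/-- The socle of a comodule: the sum of its simple subcomodules. -/
noncomputable def socle (M : RightComodule K C) : Submodule K M.carrier :=
  sSup {p | ∃ hp : M.IsSub p, (M.sub p hp).IsSimple}

/-- The comodule `V ⊗ M` with structure map `V ⊗ ρ`, for a vector space `V`. -/
noncomputable def tensorLeft (V : Type u) [AddCommGroup V] [Module K V]
    (M : RightComodule K C) : RightComodule K C where
  carrier := V ⊗[K] M.carrier
  coact := (TensorProduct.assoc K V M.carrier C).symm.toLinearMap ∘ₗ M.coact.lTensor V
  coassoc := by
    apply TensorProduct.ext'
    intro v m
    have h := congrArg (fun t => (TensorProduct.assoc K V M.carrier (C ⊗[K] C)).symm (v ⊗ₜ t))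
      (M.coassoc_apply m)
    simp only [LinearMap.comp_apply, LinearEquiv.coe_coe, LinearMap.lTensor_tmul]
    refine Eq.trans ?_ (h.trans ?_)
    · induction M.coact m using TensorProduct.induction_on with
      | zero => simp
      | add a b ha hb => simp only [TensorProduct.tmul_add, map_add, ha, hb]
      | tmul a c =>
        simp only [TensorProduct.assoc_symm_tmul, LinearMap.rTensor_tmul, LinearMap.comp_apply,
          LinearMap.lTensor_tmul, LinearEquiv.coe_coe]
        induction M.coact a using TensorProduct.induction_on with
        | zero => simp
        | add a b ha hb =>
          simp only [TensorProduct.tmul_add, TensorProduct.add_tmul, map_add, ha, hb]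
        | tmul a c => simp
    · induction M.coact m using TensorProduct.induction_on with
      | zero => simp
      | add a b ha hb => simp only [TensorProduct.tmul_add, map_add, ha, hb]
      | tmul a c => simp
  lTensor_counit_comp_coact := by
    apply TensorProduct.ext'
    intro v m
    have h := congrArg (fun t => (TensorProduct.assoc K V M.carrier K).symm (v ⊗ₜ t))
      (M.counit_apply m)
    simp only [LinearMap.comp_apply, LinearEquiv.coe_coe, LinearMap.lTensor_tmul]
    refine Eq.trans ?_ (h.trans ?_)
    · induction M.coact m using TensorProduct.induction_on with
      | zero => simp
      | add a b ha hb => simp only [TensorProduct.tmul_add, map_add, ha, hb]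
      | tmul a c => simp
    · simp

theorem isSub_ker {M N : RightComodule K C} {f : M.carrier →ₗ[K] N.carrier}
    (hf : IsHom M N f) : M.IsSub (LinearMap.ker f) := by
  intro x hx
  have hex : Function.Exact (LinearMap.ker f).subtype f := LinearMap.exact_subtype_ker_map f
  apply (Module.Flat.rTensor_exact C hex _).1
  have := LinearMap.congr_fun hf x
  simp only [LinearMap.comp_apply] at this
  rw [this, LinearMap.mem_ker.1 hx, map_zero]

theorem IsHom.comp {M N P : RightComodule K C} {f : M.carrier →ₗ[K] N.carrier}
    {g : N.carrier →ₗ[K] P.carrier} (hf : IsHom M N f) (hg : IsHom N P g) :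
    IsHom M P (g ∘ₗ f) := by
  unfold IsHom at *
  rw [LinearMap.rTensor_comp, LinearMap.comp_assoc, hf, ← LinearMap.comp_assoc, hg,
    LinearMap.comp_assoc]

theorem IsHom.sub {M N : RightComodule K C} {f g : M.carrier →ₗ[K] N.carrier}
    (hf : IsHom M N f) (hg : IsHom M N g) : IsHom M N (f - g) := by
  unfold IsHom at *
  rw [LinearMap.rTensor_sub, LinearMap.sub_comp, hf, hg, LinearMap.comp_sub]

theorem IsHom.lTensor {M N : RightComodule K C} {f : M.carrier →ₗ[K] N.carrier}
    (V : Type u) [AddCommGroup V] [Module K V] (hf : IsHom M N f) :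
    IsHom (tensorLeft V M) (tensorLeft V N) (f.lTensor V) := by
  apply TensorProduct.ext'
  intro v m
  have h := congrArg (fun t => (TensorProduct.assoc K V N.carrier C).symm (v ⊗ₜ t))
    (LinearMap.congr_fun hf m)
  refine Eq.trans ?_ h
  change (f.lTensor V).rTensor C ((TensorProduct.assoc K V M.carrier C).symm
    (v ⊗ₜ M.coact m)) = (TensorProduct.assoc K V N.carrier C).symm
    (v ⊗ₜ (f.rTensor C (M.coact m)))
  induction M.coact m using TensorProduct.induction_on with
  | zero => simp
  | add a b ha hb => simp only [TensorProduct.tmul_add, map_add, ha, hb]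
  | tmul a c => simp

theorem IsHom.rTensor {V W : Type u} [AddCommGroup V] [Module K V] [AddCommGroup W]
    [Module K W] (g : V →ₗ[K] W) (M : RightComodule K C) :
    IsHom (tensorLeft V M) (tensorLeft W M) (g.rTensor M.carrier) := by
  apply TensorProduct.ext'
  intro v m
  change (g.rTensor M.carrier).rTensor C ((TensorProduct.assoc K V M.carrier C).symm
    (v ⊗ₜ M.coact m)) = (TensorProduct.assoc K W M.carrier C).symm (g v ⊗ₜ M.coact m)
  induction M.coact m using TensorProduct.induction_on with
  | zero => simp
  | add a b ha hb => simp only [TensorProduct.tmul_add, map_add, ha, hb]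
  | tmul a c => simp

theorem IsHom.assoc (V W : Type u) [AddCommGroup V] [Module K V] [AddCommGroup W]
    [Module K W] (M : RightComodule K C) :
    IsHom (tensorLeft (V ⊗[K] W) M) (tensorLeft V (tensorLeft W M))
      (TensorProduct.assoc K V W M.carrier).toLinearMap := by
  apply TensorProduct.ext_threefold
  intro v w m
  change (TensorProduct.assoc K V W M.carrier).toLinearMap.rTensor C
    ((TensorProduct.assoc K (V ⊗[K] W) M.carrier C).symm ((v ⊗ₜ w) ⊗ₜ M.coact m)) =
    (TensorProduct.assoc K V (W ⊗[K] M.carrier) C).symm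
      (v ⊗ₜ (TensorProduct.assoc K W M.carrier C).symm (w ⊗ₜ M.coact m))
  induction M.coact m using TensorProduct.induction_on with
  | zero => simp
  | add a b ha hb => simp only [TensorProduct.tmul_add, map_add, ha, hb]
  | tmul a c => simp

end Basic


end RightComodule

/-! ### The dual algebra acting on comodules, and the localized coalgebra `eCe` -/

/-- Idempotents of the dual algebra `C* = Hom(C, K)`, with its convolution product
`(f * g)(c) = ∑ f(c₁) g(c₂)`. -/
abbrev DualIdempotent (K C : Type u) [Field K] [AddCommGroup C] [Module K C]
    [Coalgebra K C] : Type u :=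
  {e : WithConv (C →ₗ[K] K) // IsIdempotentElem e}

section Localization

variable {K C : Type u} [Field K] [AddCommGroup C] [Module K C] [Coalgebra K C]

/-- The left action of `f ∈ C*` on a right comodule: `f · x = ∑ x₀ f(x₁)`. -/
noncomputable def RightComodule.act (M : RightComodule K C) (f : C →ₗ[K] K) :
    M.carrier →ₗ[K] M.carrier :=
  (TensorProduct.rid K M.carrier).toLinearMap ∘ₗ f.lTensor M.carrier ∘ₗ M.coact

/-- The left action of `f ∈ C*` on `C`: `f · c = ∑ c₁ f(c₂)`. -/
noncomputable def dualLeft (f : C →ₗ[K] K) : C →ₗ[K] C :=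
  (TensorProduct.rid K C).toLinearMap ∘ₗ f.lTensor C ∘ₗ comul

/-- The right action of `f ∈ C*` on `C`: `c · f = ∑ f(c₁) c₂`. -/
noncomputable def dualRight (f : C →ₗ[K] K) : C →ₗ[K] C :=
  (TensorProduct.lid K C).toLinearMap ∘ₗ f.rTensor C ∘ₗ comul

theorem RightComodule.coact_act (M : RightComodule K C) (f : C →ₗ[K] K) (x : M.carrier) :
    M.coact (M.act f x) = (dualLeft f).lTensor M.carrier (M.coact x) := by
  have h1 : ∀ t : M.carrier ⊗[K] C,
      M.coact (TensorProduct.rid K M.carrier (f.lTensor M.carrier t)) =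
      TensorProduct.rid K (M.carrier ⊗[K] C)
        (f.lTensor (M.carrier ⊗[K] C) (M.coact.rTensor C t)) := by
    intro t
    induction t using TensorProduct.induction_on with
    | zero => simp
    | add a b ha hb => simp only [map_add, ha, hb]
    | tmul a c => simp
  have h2 : ∀ t : M.carrier ⊗[K] C,
      TensorProduct.rid K (M.carrier ⊗[K] C) (f.lTensor (M.carrier ⊗[K] C)
        ((TensorProduct.assoc K M.carrier C C).symm
          ((comul (R := K) (A := C)).lTensor M.carrier t))) =
      (dualLeft f).lTensor M.carrier t := by
    intro t
    induction t using TensorProduct.induction_on with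
    | zero => simp
    | add a b ha hb => simp only [map_add, ha, hb]
    | tmul a c =>
      simp only [LinearMap.lTensor_tmul, dualLeft, LinearMap.comp_apply, LinearEquiv.coe_coe]
      induction (comul (R := K) c) using TensorProduct.induction_on with
      | zero => simp
      | add a b ha hb => simp only [TensorProduct.tmul_add, map_add, ha, hb]
      | tmul a c => simp
  have h3 := h1 (M.coact x)
  rw [(LinearEquiv.eq_symm_apply _).2 (M.coassoc_apply x), h2] at h3
  exact h3

theorem RightComodule.act_coact (M : RightComodule K C) (f : C →ₗ[K] K) (x : M.carrier) :
    (M.act f).rTensor C (M.coact x) = (dualRight f).lTensor M.carrier (M.coact x) := by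
  have h1 : ∀ t : M.carrier ⊗[K] C,
      (M.act f).rTensor C t = ((TensorProduct.lid K C).toLinearMap ∘ₗ f.rTensor C).lTensor _
        (TensorProduct.assoc K M.carrier C C (M.coact.rTensor C t)) := by
    intro t
    induction t using TensorProduct.induction_on with
    | zero => simp
    | add a b ha hb => simp only [map_add, ha, hb]
    | tmul a c =>
      simp only [LinearMap.rTensor_tmul, RightComodule.act, LinearMap.comp_apply,
        LinearEquiv.coe_coe]
      induction (M.coact a) using TensorProduct.induction_on with
      | zero => simp
      | add a b ha hb => simp only [TensorProduct.add_tmul, map_add, ha, hb]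
      | tmul a c => simp [TensorProduct.smul_tmul]
  rw [h1, M.coassoc_apply, ← LinearMap.lTensor_comp_apply]
  rfl

theorem RightComodule.act_act (M : RightComodule K C) (e : DualIdempotent K C)
    (x : M.carrier) : M.act e.1.ofConv (M.act e.1.ofConv x) = M.act e.1.ofConv x := by
  have he : ∀ c : C, e.1.ofConv (dualLeft e.1.ofConv c) = e.1.ofConv c := by
    intro c
    have h := congrArg (fun g : WithConv (C →ₗ[K] K) => g.ofConv c) e.2
    refine Eq.trans ?_ h
    change _ = LinearMap.mul' K K (TensorProduct.map e.1.ofConv e.1.ofConv (comul c))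
    simp only [dualLeft, LinearMap.comp_apply, LinearEquiv.coe_coe]
    induction (comul (R := K) c) using TensorProduct.induction_on with
    | zero => simp
    | add a b ha hb => simp only [map_add, ha, hb]
    | tmul a c => simp [mul_comm]
  have h := M.coact_act e.1.ofConv x
  change TensorProduct.rid K M.carrier (e.1.ofConv.lTensor M.carrier
    (M.coact (M.act e.1.ofConv x))) = _
  rw [h, ← LinearMap.lTensor_comp_apply]
  have h2 : e.1.ofConv ∘ₗ dualLeft e.1.ofConv = e.1.ofConv := LinearMap.ext he
  rw [h2]; rfl

theorem comul_dualLeft (f : C →ₗ[K] K) (c : C) :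
    comul (R := K) (dualLeft f c) = (dualLeft f).lTensor C (comul c) :=
  (RightComodule.regular K C).coact_act f c

theorem dualLeft_comul (f : C →ₗ[K] K) (c : C) :
    (dualLeft f).rTensor C (comul (R := K) c) = (dualRight f).lTensor C (comul c) :=
  (RightComodule.regular K C).act_coact f c

theorem dualLeft_dualLeft (e : DualIdempotent K C) (c : C) :
    dualLeft e.1.ofConv (dualLeft e.1.ofConv c) = dualLeft e.1.ofConv c :=
  (RightComodule.regular K C).act_act e c

theorem comul_dualRight (f : C →ₗ[K] K) (c : C) :
    comul (R := K) (dualRight f c) = (dualRight f).rTensor C (comul c) := by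
  have h1 : ∀ t : C ⊗[K] C,
      comul (R := K) (TensorProduct.lid K C (f.rTensor C t)) =
      TensorProduct.lid K (C ⊗[K] C) (f.rTensor (C ⊗[K] C) (comul.lTensor C t)) := by
    intro t
    induction t using TensorProduct.induction_on with
    | zero => simp
    | add a b ha hb => simp only [map_add, ha, hb]
    | tmul a c => simp
  have h2 : ∀ t : C ⊗[K] C,
      TensorProduct.lid K (C ⊗[K] C) (f.rTensor (C ⊗[K] C)
        (TensorProduct.assoc K C C C (comul.rTensor C t))) = (dualRight f).rTensor C t := by
    intro t
    induction t using TensorProduct.induction_on with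
    | zero => simp
    | add a b ha hb => simp only [map_add, ha, hb]
    | tmul a c =>
      simp only [LinearMap.rTensor_tmul, dualRight, LinearMap.comp_apply, LinearEquiv.coe_coe]
      induction (comul (R := K) a) using TensorProduct.induction_on with
      | zero => simp
      | add a b ha hb => simp only [TensorProduct.add_tmul, map_add, ha, hb]
      | tmul a c => simp [TensorProduct.smul_tmul']
  have h3 := h1 (comul c)
  rw [← Coalgebra.coassoc_apply, h2] at h3
  exact h3

theorem dualRight_dualRight (e : DualIdempotent K C) (c : C) :
    dualRight e.1.ofConv (dualRight e.1.ofConv c) = dualRight e.1.ofConv c := by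
  have he : ∀ c : C, e.1.ofConv (dualRight e.1.ofConv c) = e.1.ofConv c := by
    intro c
    have h := congrArg (fun g : WithConv (C →ₗ[K] K) => g.ofConv c) e.2
    refine Eq.trans ?_ h
    change _ = LinearMap.mul' K K (TensorProduct.map e.1.ofConv e.1.ofConv (comul c))
    simp only [dualRight, LinearMap.comp_apply, LinearEquiv.coe_coe]
    induction (comul (R := K) c) using TensorProduct.induction_on with
    | zero => simp
    | add a b ha hb => simp only [map_add, ha, hb]
    | tmul a c => simp
  change TensorProduct.lid K C (e.1.ofConv.rTensor C
    (comul (dualRight e.1.ofConv c))) = _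
  rw [comul_dualRight, ← LinearMap.rTensor_comp_apply]
  have h2 : e.1.ofConv ∘ₗ dualRight e.1.ofConv = e.1.ofConv := LinearMap.ext he
  rw [h2]; rfl

theorem dualLeft_dualRight (f g : C →ₗ[K] K) (c : C) :
    dualLeft f (dualRight g c) = dualRight g (dualLeft f c) := by
  have h : ∀ t : C ⊗[K] C, TensorProduct.rid K C (f.lTensor C ((dualRight g).rTensor C t)) =
      dualRight g (TensorProduct.rid K C (f.lTensor C t)) := by
    intro t
    induction t using TensorProduct.induction_on with
    | zero => simp
    | add a b ha hb => simp only [map_add, ha, hb]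
    | tmul a c => simp
  change TensorProduct.rid K C (f.lTensor C (comul (dualRight g c))) = _
  rw [comul_dualRight, h]
  rfl

namespace DualIdempotent

/-- The map `x ↦ exe` on `C`. -/
noncomputable def corner (e : DualIdempotent K C) : C →ₗ[K] C :=
  dualLeft e.1.ofConv ∘ₗ dualRight e.1.ofConv

/-- The underlying space of the localized coalgebra `eCe = {exe | x ∈ C}`. -/
noncomputable abbrev Corner (e : DualIdempotent K C) : Submodule K C := LinearMap.range e.corner

/-- The surjection `C → eCe`, `x ↦ exe`. -/
noncomputable def toCorner (e : DualIdempotent K C) : C →ₗ[K] e.Corner :=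
  e.corner.rangeRestrict

theorem corner_corner (e : DualIdempotent K C) (c : C) :
    e.corner (e.corner c) = e.corner c := by
  simp only [corner, LinearMap.comp_apply]
  rw [← dualLeft_dualRight, dualRight_dualRight, dualLeft_dualLeft]

theorem toCorner_coe (e : DualIdempotent K C) (x : e.Corner) : e.toCorner x = x := by
  obtain ⟨_, c, rfl⟩ := x
  exact Subtype.ext (e.corner_corner c)

theorem toCorner_dualLeft (e : DualIdempotent K C) :
    e.toCorner ∘ₗ dualLeft e.1.ofConv = e.toCorner := by
  ext c
  change dualLeft e.1.ofConv (dualRight e.1.ofConv (dualLeft e.1.ofConv c)) =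
    dualLeft e.1.ofConv (dualRight e.1.ofConv c)
  rw [← dualLeft_dualRight, dualLeft_dualLeft]

theorem toCorner_dualRight (e : DualIdempotent K C) :
    e.toCorner ∘ₗ dualRight e.1.ofConv = e.toCorner := by
  ext c
  change dualLeft e.1.ofConv (dualRight e.1.ofConv (dualRight e.1.ofConv c)) =
    dualLeft e.1.ofConv (dualRight e.1.ofConv c)
  rw [dualRight_dualRight]

/-- The comultiplication of `eCe`: `Δ(exe) = ∑ ex₁e ⊗ ex₂e`. -/
noncomputable def cornerComul (e : DualIdempotent K C) :
    e.Corner →ₗ[K] e.Corner ⊗[K] e.Corner :=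
  TensorProduct.map e.toCorner e.toCorner ∘ₗ comul ∘ₗ e.Corner.subtype

theorem cornerComul_toCorner (e : DualIdempotent K C) (c : C) :
    e.cornerComul (e.toCorner c) = TensorProduct.map e.toCorner e.toCorner (comul c) := by
  change TensorProduct.map e.toCorner e.toCorner
    (comul (dualLeft e.1.ofConv (dualRight e.1.ofConv c))) = _
  rw [comul_dualLeft, comul_dualRight, ← LinearMap.comp_apply (TensorProduct.map _ _),
    LinearMap.map_comp_lTensor, ← LinearMap.comp_apply (TensorProduct.map _ _),
    LinearMap.map_comp_rTensor, toCorner_dualLeft, toCorner_dualRight]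

theorem lTensor_cornerComul (e : DualIdempotent K C) {V W : Type u} [AddCommGroup V]
    [Module K V] [AddCommGroup W] [Module K W] (q : V →ₗ[K] W) (t : V ⊗[K] C) :
    e.cornerComul.lTensor W (TensorProduct.map q e.toCorner t) =
      TensorProduct.map q (TensorProduct.map e.toCorner e.toCorner)
        ((comul (R := K) (A := C)).lTensor V t) := by
  induction t using TensorProduct.induction_on with
  | zero => simp
  | add a b ha hb => simp only [map_add, ha, hb]
  | tmul a c => simp [cornerComul_toCorner]

theorem assoc_rTensor_map (e : DualIdempotent K C) {V W : Type u} [AddCommGroup V]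
    [Module K V] [AddCommGroup W] [Module K W] (q : V →ₗ[K] W) (r : V →ₗ[K] V ⊗[K] C)
    (r' : W →ₗ[K] W ⊗[K] e.Corner)
    (h : ∀ x, r' (q x) = TensorProduct.map q e.toCorner (r x)) (t : V ⊗[K] C) :
    TensorProduct.assoc K W e.Corner e.Corner
        (r'.rTensor e.Corner (TensorProduct.map q e.toCorner t)) =
      TensorProduct.map q (TensorProduct.map e.toCorner e.toCorner)
        (TensorProduct.assoc K V C C (r.rTensor C t)) := by
  induction t using TensorProduct.induction_on with
  | zero => simp
  | add a b ha hb => simp only [map_add, ha, hb]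
  | tmul a c =>
    simp only [TensorProduct.map_tmul, LinearMap.rTensor_tmul, h]
    induction r a using TensorProduct.induction_on with
    | zero => simp
    | add a b ha hb => simp only [TensorProduct.add_tmul, map_add, ha, hb]
    | tmul a c => simp

theorem rTensor_comul (e : DualIdempotent K C) (c : C) :
    e.1.ofConv.rTensor C (comul c) = 1 ⊗ₜ dualRight e.1.ofConv c := by
  apply (TensorProduct.lid K C).injective
  simp [dualRight]

theorem lTensor_coact (e : DualIdempotent K C) (M : RightComodule K C) (x : M.carrier) :
    e.1.ofConv.lTensor M.carrier (M.coact x) = M.act e.1.ofConv x ⊗ₜ 1 := by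
  apply (TensorProduct.rid K M.carrier).injective
  simp [RightComodule.act]

theorem lTensor_comul (e : DualIdempotent K C) (c : C) :
    e.1.ofConv.lTensor C (comul c) = dualLeft e.1.ofConv c ⊗ₜ 1 :=
  e.lTensor_coact (RightComodule.regular K C) c

theorem counit_toCorner (e : DualIdempotent K C) :
    (counit (R := K) (A := C) ∘ₗ e.Corner.subtype) ∘ₗ e.toCorner = e.1.ofConv := by
  have h1 : ∀ c : C, counit (R := K) (dualLeft e.1.ofConv c) = e.1.ofConv c := by
    intro c
    have h := congrArg (fun t => e.1.ofConv (TensorProduct.lid K C t))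
      (Coalgebra.rTensor_counit_comul (R := K) c)
    refine Eq.trans ?_ (h.trans ?_)
    · simp only [dualLeft, LinearMap.comp_apply, LinearEquiv.coe_coe]
      induction (comul (R := K) c) using TensorProduct.induction_on with
      | zero => simp
      | add a b ha hb => simp only [map_add, ha, hb]
      | tmul a c => simp [mul_comm]
    · simp
  have h2 : ∀ c : C, e.1.ofConv (dualRight e.1.ofConv c) = e.1.ofConv c := by
    intro c
    have h := congrArg (fun g : WithConv (C →ₗ[K] K) => g.ofConv c) e.2
    refine Eq.trans ?_ h
    change _ = LinearMap.mul' K K (TensorProduct.map e.1.ofConv e.1.ofConv (comul c))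
    simp only [dualRight, LinearMap.comp_apply, LinearEquiv.coe_coe]
    induction (comul (R := K) c) using TensorProduct.induction_on with
    | zero => simp
    | add a b ha hb => simp only [map_add, ha, hb]
    | tmul a c => simp
  ext c
  exact (h1 _).trans (h2 c)

theorem lTensor_counit_map (e : DualIdempotent K C) {V W : Type u} [AddCommGroup V]
    [Module K V] [AddCommGroup W] [Module K W] (q : V →ₗ[K] W) (t : V ⊗[K] C) :
    (counit (R := K) (A := C) ∘ₗ e.Corner.subtype).lTensor W
        (TensorProduct.map q e.toCorner t) = q.rTensor K (e.1.ofConv.lTensor V t) := by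
  rw [← LinearMap.comp_apply, LinearMap.lTensor_comp_map, counit_toCorner,
    ← LinearMap.comp_apply, LinearMap.rTensor_comp_lTensor]


/-- The coalgebra structure of `eCe`; its counit is the restriction of that of `C`. -/
noncomputable instance instCoalgebraCorner (e : DualIdempotent K C) :
    Coalgebra K e.Corner where
  comul := e.cornerComul
  counit := counit ∘ₗ e.Corner.subtype
  coassoc := by
    ext x
    simp only [LinearMap.comp_apply, LinearEquiv.coe_coe]
    change TensorProduct.assoc K e.Corner e.Corner e.Corner (e.cornerComul.rTensor e.Corner
      (TensorProduct.map e.toCorner e.toCorner (comul (x : C)))) =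
      e.cornerComul.lTensor e.Corner (TensorProduct.map e.toCorner e.toCorner (comul (x : C)))
    rw [e.assoc_rTensor_map _ comul _ e.cornerComul_toCorner, lTensor_cornerComul,
      Coalgebra.coassoc_apply]
  rTensor_counit_comp_comul := by
    ext x
    change (counit (R := K) (A := C) ∘ₗ e.Corner.subtype).rTensor e.Corner
      (TensorProduct.map e.toCorner e.toCorner (comul (x : C))) = 1 ⊗ₜ x
    rw [← LinearMap.comp_apply, LinearMap.rTensor_comp_map, counit_toCorner,
      ← LinearMap.lTensor_comp_rTensor, LinearMap.comp_apply, rTensor_comul,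
      LinearMap.lTensor_tmul, ← LinearMap.comp_apply, toCorner_dualRight, toCorner_coe]
  lTensor_counit_comp_comul := by
    ext x
    change (counit (R := K) (A := C) ∘ₗ e.Corner.subtype).lTensor e.Corner
      (TensorProduct.map e.toCorner e.toCorner (comul (x : C))) = x ⊗ₜ 1
    rw [lTensor_counit_map, lTensor_comul, LinearMap.rTensor_tmul, ← LinearMap.comp_apply,
      toCorner_dualLeft, toCorner_coe]

end DualIdempotent

/-- The space `eM` for a right comodule `M`. -/
noncomputable abbrev RightComodule.localSpace (M : RightComodule K C) (e : DualIdempotent K C) :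
    Submodule K M.carrier := LinearMap.range (M.act e.1.ofConv)

/-- The surjection `M → eM`, `x ↦ ex`. -/
noncomputable def RightComodule.toLocal (M : RightComodule K C) (e : DualIdempotent K C) :
    M.carrier →ₗ[K] M.localSpace e := (M.act e.1.ofConv).rangeRestrict

/-- The structure map `eM → eM ⊗ eCe` of `eM`: `y ↦ ∑ e y₀ ⊗ e y₁ e`. -/
noncomputable def RightComodule.localCoact (M : RightComodule K C) (e : DualIdempotent K C) :
    M.localSpace e →ₗ[K] M.localSpace e ⊗[K] e.Corner :=
  TensorProduct.map (M.toLocal e) e.toCorner ∘ₗ M.coact ∘ₗ (M.localSpace e).subtype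

theorem RightComodule.localCoact_toLocal (M : RightComodule K C) (e : DualIdempotent K C)
    (x : M.carrier) : M.localCoact e (M.toLocal e x) =
      TensorProduct.map (M.toLocal e) e.toCorner (M.coact x) := by
  change TensorProduct.map (M.toLocal e) e.toCorner (M.coact (M.act e.1.ofConv x)) = _
  rw [M.coact_act, ← LinearMap.comp_apply (TensorProduct.map _ _), LinearMap.map_comp_lTensor,
    e.toCorner_dualLeft]

theorem RightComodule.toLocal_coe (M : RightComodule K C) (e : DualIdempotent K C)
    (y : M.localSpace e) : M.toLocal e y = y := by
  obtain ⟨_, x, rfl⟩ := y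
  exact Subtype.ext (M.act_act e x)

/-- The quotient functor `T = e(-)` on objects: the right `eCe`-comodule `eM`. -/
noncomputable def RightComodule.localize (e : DualIdempotent K C) (M : RightComodule K C) :
    RightComodule K e.Corner where
  carrier := M.localSpace e
  coact := M.localCoact e
  coassoc := by
    ext1 x
    simp only [LinearMap.comp_apply, LinearEquiv.coe_coe]
    change TensorProduct.assoc K (M.localSpace e) e.Corner e.Corner
      ((M.localCoact e).rTensor e.Corner
      (TensorProduct.map (M.toLocal e) e.toCorner (M.coact (x : M.carrier)))) =
      e.cornerComul.lTensor (M.localSpace e)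
        (TensorProduct.map (M.toLocal e) e.toCorner (M.coact (x : M.carrier)))
    rw [e.assoc_rTensor_map _ M.coact _ (M.localCoact_toLocal e), e.lTensor_cornerComul,
      M.coassoc_apply]
  lTensor_counit_comp_coact := by
    ext1 x
    change (counit (R := K) (A := C) ∘ₗ e.Corner.subtype).lTensor (M.localSpace e)
      (TensorProduct.map (M.toLocal e) e.toCorner (M.coact (x : M.carrier))) = x ⊗ₜ 1
    have h : M.toLocal e (M.act e.1.ofConv (x : M.carrier)) = x := by
      have h' : M.act e.1.ofConv (x : M.carrier) = x := congrArg Subtype.val (M.toLocal_coe e x)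
      rw [h', M.toLocal_coe]
    rw [e.lTensor_counit_map, e.lTensor_coact, LinearMap.rTensor_tmul, h]

namespace DualIdempotent

/-- The space `Ce = {ce | c ∈ C}`. -/
noncomputable abbrev rightIdealSpace (e : DualIdempotent K C) : Submodule K C :=
  LinearMap.range (dualRight e.1.ofConv)

theorem isSub_rightIdealSpace (e : DualIdempotent K C) :
    (RightComodule.regular K C).IsSub e.rightIdealSpace := by
  rintro _ ⟨c, rfl⟩
  refine ⟨(dualRight e.1.ofConv).rangeRestrict.rTensor C (comul (R := K) c), ?_⟩
  refine Eq.trans ?_ (comul_dualRight e.1.ofConv c).symm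
  exact (LinearMap.rTensor_comp_apply _ _ _ _).symm

/-- The right `C`-comodule `Ce`, a subcomodule of `C`. -/
noncomputable def rightIdeal (e : DualIdempotent K C) : RightComodule K C :=
  (RightComodule.regular K C).sub e.rightIdealSpace e.isSub_rightIdealSpace

/-- The inclusion `Ce → C`. -/
noncomputable def rightIdealIncl (e : DualIdempotent K C) : e.rightIdeal.carrier →ₗ[K] C :=
  e.rightIdealSpace.subtype

/-- The surjection `C → Ce`, `c ↦ ce`. -/
noncomputable def toRightIdeal (e : DualIdempotent K C) : C →ₗ[K] e.rightIdeal.carrier :=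
  (dualRight e.1.ofConv).rangeRestrict

/-- The left `eCe`-coaction on `Ce`: `y ↦ ∑ e y₁ e ⊗ y₂ e`. -/
noncomputable def leftCoact (e : DualIdempotent K C) :
    e.rightIdeal.carrier →ₗ[K] e.Corner ⊗[K] e.rightIdeal.carrier :=
  TensorProduct.map e.toCorner e.toRightIdeal ∘ₗ comul ∘ₗ e.rightIdealIncl

theorem leftCoact_toRightIdeal (e : DualIdempotent K C) (c : C) :
    e.leftCoact (e.toRightIdeal c) =
      TensorProduct.map e.toCorner e.toRightIdeal (comul c) := by
  change TensorProduct.map e.toCorner e.toRightIdeal (comul (dualRight e.1.ofConv c)) = _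
  rw [comul_dualRight, ← LinearMap.comp_apply (TensorProduct.map _ _),
    LinearMap.map_comp_rTensor, toCorner_dualRight]

theorem coact_toRightIdeal (e : DualIdempotent K C) (c : C) :
    e.rightIdeal.coact (e.toRightIdeal c) = e.toRightIdeal.rTensor C (comul (R := K) c) := by
  apply RightComodule.rTensor_subtype_injective (C := C) e.rightIdealSpace
  refine (LinearMap.congr_fun ((RightComodule.regular K C).rTensor_subCoact _
    e.isSub_rightIdealSpace) (e.toRightIdeal c)).trans ?_
  refine Eq.trans ?_ (LinearMap.rTensor_comp_apply _ _ _ _)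
  exact comul_dualRight e.1.ofConv c

theorem leftCoact_isHom (e : DualIdempotent K C) :
    RightComodule.IsHom e.rightIdeal (RightComodule.tensorLeft e.Corner e.rightIdeal)
      e.leftCoact := by
  ext1 a
  obtain ⟨c, rfl⟩ : ∃ c, e.toRightIdeal c = a := LinearMap.surjective_rangeRestrict _ a
  change e.leftCoact.rTensor C (e.rightIdeal.coact (e.toRightIdeal c)) =
    (TensorProduct.assoc K e.Corner e.rightIdeal.carrier C).symm
      (e.rightIdeal.coact.lTensor e.Corner (e.leftCoact (e.toRightIdeal c)))
  have h1 : ∀ t : C ⊗[K] C, e.leftCoact.rTensor C (e.toRightIdeal.rTensor C t) =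
      (TensorProduct.assoc K e.Corner e.rightIdeal.carrier C).symm
        (TensorProduct.map e.toCorner (e.toRightIdeal.rTensor C)
          (TensorProduct.assoc K C C C ((comul (R := K) (A := C)).rTensor C t))) := by
    intro t
    induction t using TensorProduct.induction_on with
    | zero => simp
    | add a b ha hb => simp only [map_add, ha, hb]
    | tmul a c =>
      simp only [LinearMap.rTensor_tmul, leftCoact_toRightIdeal]
      induction (comul (R := K) a) using TensorProduct.induction_on with
      | zero => simp
      | add a b ha hb => simp only [TensorProduct.add_tmul, map_add, ha, hb]
      | tmul a c => simp
  have h2 : ∀ t : C ⊗[K] C, e.rightIdeal.coact.lTensor e.Corner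
      (TensorProduct.map e.toCorner e.toRightIdeal t) =
      TensorProduct.map e.toCorner (e.toRightIdeal.rTensor C)
        ((comul (R := K) (A := C)).lTensor C t) := by
    intro t
    induction t using TensorProduct.induction_on with
    | zero => simp
    | add a b ha hb => simp only [map_add, ha, hb]
    | tmul a c => simp [coact_toRightIdeal]
  rw [leftCoact_toRightIdeal, coact_toRightIdeal, h1, h2, Coalgebra.coassoc_apply]

end DualIdempotent

/-- The linear map `N ⊗ Ce → N ⊗ eCe ⊗ Ce` whose kernel is the cotensor product `N □ Ce`:
the difference of `ρ_N ⊗ Ce` and `N ⊗ λ`, where `λ` is the left coaction of `Ce`. -/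
noncomputable def RightComodule.cotensorMap (e : DualIdempotent K C)
    (N : RightComodule K e.Corner) :
    (RightComodule.tensorLeft N.carrier e.rightIdeal).carrier →ₗ[K]
      (RightComodule.tensorLeft N.carrier
        (RightComodule.tensorLeft e.Corner e.rightIdeal)).carrier :=
  (TensorProduct.assoc K N.carrier e.Corner e.rightIdeal.carrier).toLinearMap ∘ₗ
      N.coact.rTensor e.rightIdeal.carrier -
    e.leftCoact.lTensor N.carrier

theorem RightComodule.cotensorMap_isHom (e : DualIdempotent K C)
    (N : RightComodule K e.Corner) :
    RightComodule.IsHom _ _ (RightComodule.cotensorMap e N) := by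
  have h1 := IsHom.rTensor N.coact e.rightIdeal
  have h2 := IsHom.assoc N.carrier e.Corner e.rightIdeal
  have h3 := IsHom.lTensor N.carrier e.leftCoact_isHom
  have h4 := h1.comp h2
  have h5 := h4.sub h3
  exact h5

/-- The section functor `S = - □_{eCe} Ce` on objects: the right `C`-comodule `N □_{eCe} Ce`,
a subcomodule of `N ⊗ Ce`. -/
noncomputable def RightComodule.section_ (e : DualIdempotent K C)
    (N : RightComodule K e.Corner) : RightComodule K C :=
  (RightComodule.tensorLeft N.carrier e.rightIdeal).sub
    (LinearMap.ker (RightComodule.cotensorMap e N))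
    (RightComodule.isSub_ker (RightComodule.cotensorMap_isHom e N))

end Localization

/-! ### `R`-`C`-bimodules and the tameness condition -/

/-- An `R`-`C`-bimodule: a right `C`-comodule with an `R`-module structure such that
`ρ(r · x) = r · ρ(x)`. -/
structure Bimodule (R K C : Type u) [CommRing R] [Field K] [Algebra K R] [AddCommGroup C]
    [Module K C] [Coalgebra K C] extends RightComodule K C where
  [moduleR : Module R carrier]
  [isScalarTower : IsScalarTower K R carrier]
  coact_smul : ∀ (r : R) (x : carrier), coact (r • x) = r • coact x

attribute [instance] Bimodule.moduleR Bimodule.isScalarTower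

section Tame

variable {R K C : Type u} [CommRing R] [Field K] [Algebra K R] [AddCommGroup C] [Module K C]
  [Coalgebra K C]

/-- The structure map of a bimodule, as an `R`-linear map. -/
noncomputable def Bimodule.coactR (L : Bimodule R K C) :
    L.carrier →ₗ[R] L.carrier ⊗[K] C where
  toFun := L.coact
  map_add' := map_add _
  map_smul' := L.coact_smul

/-- The right `C`-comodule `V ⊗_R L`, with structure map `V ⊗_R ρ`, for an `R`-module `V` and
an `R`-`C`-bimodule `L`. -/
noncomputable def Bimodule.tensor (V : Type u) [AddCommGroup V] [Module R V] [Module K V]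
    [IsScalarTower K R V] (L : Bimodule R K C) : RightComodule K C where
  carrier := V ⊗[R] L.carrier
  coact := ((TensorProduct.AlgebraTensorModule.assoc K R R V L.carrier C).symm.toLinearMap ∘ₗ
    L.coactR.lTensor V).restrictScalars K
  coassoc := by
    ext1 x
    induction x using TensorProduct.induction_on with
    | zero => simp
    | add a b ha hb => rw [map_add, map_add, ha, hb]
    | tmul v m =>
      have h := congrArg
        (fun t => (TensorProduct.AlgebraTensorModule.assoc K R R V L.carrier (C ⊗[K] C)).symm
          (v ⊗ₜ t)) (L.coassoc_apply m)
      have hc : ∀ y : L.carrier, L.coactR y = L.coact y := fun _ => rfl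
      simp only [LinearMap.comp_apply, LinearEquiv.coe_coe, LinearMap.restrictScalars_apply,
        LinearMap.lTensor_tmul, hc]
      refine Eq.trans ?_ (h.trans ?_)
      · induction L.coact m using TensorProduct.induction_on with
        | zero => simp
        | add a b ha hb => simp only [TensorProduct.tmul_add, map_add, ha, hb]
        | tmul a c =>
          simp only [TensorProduct.AlgebraTensorModule.assoc_symm_tmul, LinearMap.rTensor_tmul,
            LinearMap.comp_apply, LinearMap.restrictScalars_apply, LinearMap.lTensor_tmul,
            LinearEquiv.coe_coe, hc]
          induction L.coact a using TensorProduct.induction_on with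
          | zero => simp
          | add a b ha hb =>
            simp only [TensorProduct.tmul_add, TensorProduct.add_tmul, map_add, ha, hb]
          | tmul a c => simp
      · induction L.coact m using TensorProduct.induction_on with
        | zero => simp
        | add a b ha hb => simp only [TensorProduct.tmul_add, map_add, ha, hb]
        | tmul a c => simp
  lTensor_counit_comp_coact := by
    ext1 x
    induction x using TensorProduct.induction_on with
    | zero => simp
    | add a b ha hb => rw [map_add, map_add, ha, hb]
    | tmul v m =>
      have h := congrArg
        (fun t => (TensorProduct.AlgebraTensorModule.assoc K R R V L.carrier K).symm
          (v ⊗ₜ t)) (L.counit_apply m)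
      have hc : ∀ y : L.carrier, L.coactR y = L.coact y := fun _ => rfl
      simp only [LinearMap.comp_apply, LinearEquiv.coe_coe, LinearMap.restrictScalars_apply,
        LinearMap.lTensor_tmul, hc]
      refine Eq.trans ?_ (h.trans ?_)
      · induction L.coact m using TensorProduct.induction_on with
        | zero => simp
        | add a b ha hb => simp only [TensorProduct.tmul_add, map_add, ha, hb]
        | tmul a c => simp
      · simp

/-- `K¹_λ ⊗_{K[t]} L`, where `K¹_λ = K[t]/(t - λ)`. -/
noncomputable def Bimodule.specialize (L : Bimodule K[X] K C) (lam : K) : RightComodule K C :=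
  L.tensor (K[X] ⧸ Ideal.span {Polynomial.X - Polynomial.C lam})

/-- The `r` bimodules `L` parametrize almost all indecomposables of length vector `v`: each `L s`
is a finitely generated free `K[t]`-module, and all but finitely many (up to isomorphism)
indecomposable right `C`-comodules `M` with length vector `v` are isomorphic to
`K¹_λ ⊗_{K[t]} L s` for some `s` and some `λ ∈ K`. -/
def IsAlmostParametrizing {I : Type*} (S : I → RightComodule K C) (v : I →₀ ℤ) {r : ℕ}
    (L : Fin r → Bimodule K[X] K C) : Prop :=
  (∀ s, Module.Finite K[X] (L s).carrier ∧ Module.Free K[X] (L s).carrier) ∧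
    ∃ (m : ℕ) (E : Fin m → RightComodule K C), ∀ M : RightComodule K C,
      M.IsIndecomposable → M.HasLengthVector S v →
        (∃ j, M.Iso (E j)) ∨ ∃ s lam, M.Iso ((L s).specialize lam)

/-- The tameness condition for the vector `v`, the simple comodules being the family `S`. -/
def TamenessCondition {I : Type*} (S : I → RightComodule K C) (v : I →₀ ℤ) : Prop :=
  ∃ (r : ℕ) (L : Fin r → Bimodule K[X] K C), IsAlmostParametrizing S v L

/-- The growth function `μ¹(v)`: the minimal number of bimodules in the tameness condition for
`v`. (It is only meaningful when the tameness condition holds for `v`.) -/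
noncomputable def growthFunction {I : Type*} (S : I → RightComodule K C) (v : I →₀ ℤ) : ℕ :=
  sInf {r : ℕ | ∃ L : Fin r → Bimodule K[X] K C, IsAlmostParametrizing S v L}

/-- `C` is basic, with `C₀ = ⨁ S i`: the `S i` are simple subcomodules of the right comodule `C`,
pairwise non-isomorphic, and the socle `C₀` of `C` is their direct sum. -/
structure IsBasicWith {I : Type*} (S : I → Submodule K C) : Prop where
  isSub : ∀ i, (RightComodule.regular K C).IsSub (S i)
  simple : ∀ i, ((RightComodule.regular K C).sub (S i) (isSub i)).IsSimple
  not_iso : ∀ i j, i ≠ j → ¬ ((RightComodule.regular K C).sub (S i) (isSub i)).Iso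
    ((RightComodule.regular K C).sub (S j) (isSub j))
  independent : iSupIndep S
  iSup_eq : ⨆ i, S i = (RightComodule.regular K C).socle

/-- The simple right `C`-comodule `S i`. -/
noncomputable def IsBasicWith.simples {I : Type*} {S : I → Submodule K C} (h : IsBasicWith S)
    (i : I) : RightComodule K C :=
  (RightComodule.regular K C).sub (S i) (h.isSub i)

/-- The index set `I_e = {i | e S i = S i}`. -/
def IsBasicWith.localIndex {I : Type*} {S : I → Submodule K C} (h : IsBasicWith S)
    (e : DualIdempotent K C) : Set I :=
  {i | (h.simples i).localSpace e = ⊤}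

/-- The simple right `eCe`-comodules `e S i`, for `i ∈ I_e`. -/
noncomputable def IsBasicWith.localSimples {I : Type*} {S : I → Submodule K C}
    (h : IsBasicWith S) (e : DualIdempotent K C) (i : h.localIndex e) :
    RightComodule K e.Corner :=
  (h.simples i).localize e

/-- The vector `v` extended by zeros from `I_e` to `I`. -/
noncomputable def extendByZero {I : Type*} {J : Set I} (v : J →₀ ℤ) : I →₀ ℤ :=
  v.mapDomain Subtype.val

end Tame

/-! The idea is to transport an indecomposable `eCe`-comodule `N` of length vector `v` to `S(N) = N
□ Ce`, use tameness of `C` there, and come back with `e(-)`. This works because of three facts: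
`eS(N) ≅ N`, `S(N)` is again indecomposable, and its length vector is `v` extended by zero. If `S(N)
≅ E j`, then `N ≅ e(E j)`; if `S(N) ≅ K¹_λ ⊗ L`, then `N ≅ e(K¹_λ ⊗ L) ≅ K¹_λ ⊗ eL`
(`Bimodule.tensor_localize_iso`). The bimodule `eL` is again finitely generated and free, because
`K[t]` is a principal ideal domain. So the `r` bimodules `L s` for `C` yield `r` bimodules `eL s`
for `eCe`, which gives both tameness and the inequality.

The adjunction between `e(-)` and `S` is used through local morphisms `φ : M → N`, that is,
morphisms `eM → N` precomposed with `x ↦ ex`. Such a `φ` induces `toCofree φ : M → N ⊗ C`, whose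
kernel is that of the adjoint morphism `M → N □ Ce` (`IsLocalHom.exists_section`). For `M = S(N)`
the counit of the adjunction is a surjective local morphism with `toCofree φ` injective
(`exists_isLocalHom_section`). These two properties alone give the three facts.

For the length vector, a composition series of `N` is pulled back to `S(N)`. By left exactness of
`S`, the factor over a simple factor `T` of `N` embeds in `S(T)`; it is nonzero, so it is all of
`S(T)` as soon as `S(T)` is simple. Every `T` is some `eS_i`
(`IsBasicWith.exists_iso_localSimples`), and since it occurs in `N`, `v_i ≠ 0` and the hypothesis
gives `S(eS_i) ≅ S_i`. That all simples have this form rests on `dim S_i = 1`, which follows from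
`C` being basic and `K` algebraically closed (`IsBasicWith.finrank_simples`). -/

namespace RightComodule

/-! ### Morphisms, subcomodules and simple comodules -/

section Generalities

/-- Relative to a basis of `W`, the coordinates of `t` are its slices by the coordinate functionals.
-/
theorem eq_zero_of_forall_lTensor {K V W : Type u} [Field K] [AddCommGroup V] [Module K V]
    [AddCommGroup W] [Module K W] (t : V ⊗[K] W)
    (h : ∀ f : W →ₗ[K] K, f.lTensor V t = 0) : t = 0 := by
  classical
  let b := Module.Basis.ofVectorSpace K W
  apply (TensorProduct.equivFinsuppOfBasisRight (M := V) b).injective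
  ext i
  have h1 := congrArg (TensorProduct.rid K V) (h (b.coord i))
  rw [map_zero] at h1
  rw [map_zero, Finsupp.zero_apply, ← h1]
  clear h h1
  induction t using TensorProduct.induction_on with
  | zero => simp
  | add x y hx hy => simp only [map_add, Finsupp.add_apply, hx, hy]
  | tmul a c => simp

theorem range_rTensor_subtype_mono {K C V : Type u} [Field K] [AddCommGroup C] [Module K C]
    [AddCommGroup V] [Module K V]
    {p q : Submodule K V} (h : p ≤ q) :
    LinearMap.range (p.subtype.rTensor C) ≤ LinearMap.range (q.subtype.rTensor C) := by
  rintro _ ⟨t, rfl⟩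
  refine ⟨(Submodule.inclusion h).rTensor C t, ?_⟩
  rw [← LinearMap.rTensor_comp_apply]
  rfl

variable {K : Type u} [Field K] {C : Type u} [AddCommGroup C] [Module K C] [Coalgebra K C]
  {M N P : RightComodule K C}

theorem IsHom.apply {f : M.carrier →ₗ[K] N.carrier} (hf : IsHom M N f) (x : M.carrier) :
    f.rTensor C (M.coact x) = N.coact (f x) :=
  LinearMap.congr_fun hf x

theorem IsHom.id (M : RightComodule K C) : IsHom M M LinearMap.id := by
  simp [IsHom]

theorem IsHom.smul_id (M : RightComodule K C) (a : K) : IsHom M M (a • LinearMap.id) := by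
  simp [IsHom, LinearMap.rTensor_smul, LinearMap.comp_smul, LinearMap.smul_comp]

theorem IsHom.of_comp_injective {f : M.carrier →ₗ[K] N.carrier} {g : N.carrier →ₗ[K] P.carrier}
    (hg : IsHom N P g) (hinj : Function.Injective g) (hgf : IsHom M P (g ∘ₗ f)) :
    IsHom M N f := by
  refine LinearMap.ext fun x => ?_
  apply Module.Flat.rTensor_preserves_injective_linearMap (M := C) _ hinj
  have := hgf.apply x
  rw [LinearMap.rTensor_comp_apply] at this
  exact this.trans (hg.apply _).symm

theorem IsHom.of_comp_surjective {f : M.carrier →ₗ[K] N.carrier}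
    {g : N.carrier →ₗ[K] P.carrier} (hf : IsHom M N f) (hsurj : Function.Surjective f)
    (hgf : IsHom M P (g ∘ₗ f)) : IsHom N P g := by
  refine LinearMap.ext fun y => ?_
  obtain ⟨x, rfl⟩ := hsurj y
  have := hgf.apply x
  rw [LinearMap.rTensor_comp_apply, hf.apply] at this
  exact this

theorem Iso.of_bijective {f : M.carrier →ₗ[K] N.carrier} (hf : IsHom M N f)
    (hbij : Function.Bijective f) : M.Iso N :=
  ⟨LinearEquiv.ofBijective f hbij, hf⟩

theorem Iso.symm (h : M.Iso N) : N.Iso M := by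
  obtain ⟨f, hf⟩ := h
  refine ⟨f.symm, hf.of_comp_injective f.injective ?_⟩
  have : f.toLinearMap ∘ₗ f.symm.toLinearMap = LinearMap.id := by ext; simp
  rw [this]
  exact IsHom.id N

theorem Iso.trans (h : M.Iso N) (h' : N.Iso P) : M.Iso P := by
  obtain ⟨f, hf⟩ := h
  obtain ⟨g, hg⟩ := h'
  exact ⟨f.trans g, hf.comp hg⟩

/-- Over a field `- ⊗ C` is exact, so `p ⊗ C` is the kernel of `M ⊗ C → (M/p) ⊗ C`. -/
theorem isSub_iff (M : RightComodule K C) (p : Submodule K M.carrier) :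
    M.IsSub p ↔ ∀ x ∈ p, p.mkQ.rTensor C (M.coact x) = 0 := by
  have hex : Function.Exact p.subtype p.mkQ := LinearMap.exact_subtype_mkQ p
  exact forall₂_congr fun x _ => ((Module.Flat.rTensor_exact C hex _)).symm

theorem isSub_range {f : M.carrier →ₗ[K] N.carrier} (hf : IsHom M N f) :
    N.IsSub (LinearMap.range f) := by
  rintro _ ⟨x, rfl⟩
  refine ⟨f.rangeRestrict.rTensor C (M.coact x), ?_⟩
  rw [← hf.apply, ← LinearMap.rTensor_comp_apply]
  rfl

theorem isSub_top (M : RightComodule K C) : M.IsSub ⊤ := by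
  rw [← LinearMap.range_id]
  exact isSub_range (IsHom.id M)

theorem isSub_iSup {ι : Sort*} {p : ι → Submodule K M.carrier} (h : ∀ i, M.IsSub (p i)) :
    M.IsSub (⨆ i, p i) := by
  have : (⨆ i, p i) ≤ (LinearMap.range ((⨆ i, p i).subtype.rTensor C)).comap M.coact :=
    iSup_le fun i x hx => range_rTensor_subtype_mono (le_iSup p i) (h i x hx)
  exact this

theorem isSub_act {p : Submodule K M.carrier} (hp : M.IsSub p) (f : C →ₗ[K] K) {x : M.carrier}
    (hx : x ∈ p) : M.act f x ∈ p := by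
  obtain ⟨t, ht⟩ := hp x hx
  have h : M.act f x = p.subtype (TensorProduct.rid K p (f.lTensor p t)) := by
    simp only [act, LinearMap.comp_apply, LinearEquiv.coe_coe]
    rw [← ht]
    clear ht
    induction t using TensorProduct.induction_on with
    | zero => simp
    | add a b ha hb => simp only [map_add, ha, hb]
    | tmul a c => simp
  rw [h]
  exact Subtype.property _

/-- The canonical projection to a quotient comodule. -/
noncomputable def quotMk (M : RightComodule K C) (p : Submodule K M.carrier) (hp : M.IsSub p) :
    M.carrier →ₗ[K] (M.quot p hp).carrier := p.mkQ

theorem quotMk_isHom (M : RightComodule K C) (p : Submodule K M.carrier) (hp : M.IsSub p) :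
    IsHom M (M.quot p hp) (M.quotMk p hp) := by
  ext x
  rfl

theorem ker_quotMk (M : RightComodule K C) (p : Submodule K M.carrier) (hp : M.IsSub p) :
    LinearMap.ker (M.quotMk p hp) = p :=
  p.ker_mkQ

theorem quotMk_surjective (M : RightComodule K C) (p : Submodule K M.carrier) (hp : M.IsSub p) :
    Function.Surjective (M.quotMk p hp) :=
  p.mkQ_surjective

theorem subIncl_injective (M : RightComodule K C) (p : Submodule K M.carrier) (hp : M.IsSub p) :
    Function.Injective (M.subIncl p hp) :=
  p.injective_subtype

theorem range_subIncl (M : RightComodule K C) (p : Submodule K M.carrier) (hp : M.IsSub p) :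
    LinearMap.range (M.subIncl p hp) = p :=
  p.range_subtype

/-- A morphism with values in a subcomodule, as a morphism to the subcomodule. -/
theorem IsHom.exists_lift {f : M.carrier →ₗ[K] N.carrier} (hf : IsHom M N f)
    {g : P.carrier →ₗ[K] N.carrier} (hg : IsHom P N g) (hinj : Function.Injective g)
    (h : LinearMap.range f ≤ LinearMap.range g) :
    ∃ k : M.carrier →ₗ[K] P.carrier, IsHom M P k ∧ g ∘ₗ k = f := by
  let k : M.carrier →ₗ[K] P.carrier := (LinearEquiv.ofInjective g hinj).symm.toLinearMap ∘ₗ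
    f.codRestrict (LinearMap.range g) fun x => h ⟨x, rfl⟩
  have hk : g ∘ₗ k = f := by
    ext x
    exact congrArg Subtype.val ((LinearEquiv.ofInjective g hinj).apply_symm_apply _)
  exact ⟨k, hg.of_comp_injective hinj (hk ▸ hf), hk⟩

theorem Iso.quot_of_surjective {f : M.carrier →ₗ[K] N.carrier} (hf : IsHom M N f)
    (hsurj : Function.Surjective f) (p : Submodule K M.carrier) (hp : M.IsSub p)
    (hker : LinearMap.ker f = p) : (M.quot p hp).Iso N := by
  subst hker
  let g : (M.quot _ hp).carrier ≃ₗ[K] N.carrier := f.quotKerEquivOfSurjective hsurj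
  have h : g.toLinearMap ∘ₗ M.quotMk _ hp = f := by
    ext x
    rfl
  exact ⟨g, (M.quotMk_isHom _ hp).of_comp_surjective (M.quotMk_surjective _ hp) (h.symm ▸ hf)⟩

theorem IsHom.injective_of_isSimple {f : M.carrier →ₗ[K] N.carrier} (hf : IsHom M N f)
    (hM : M.IsSimple) (h0 : f ≠ 0) : Function.Injective f := by
  rcases hM.2 _ (isSub_ker hf) with h | h
  · exact LinearMap.ker_eq_bot.1 h
  · exact absurd (LinearMap.ker_eq_top.1 h) h0

theorem IsHom.surjective_of_isSimple {f : M.carrier →ₗ[K] N.carrier} (hf : IsHom M N f)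
    (hN : N.IsSimple) (h0 : f ≠ 0) : Function.Surjective f := by
  rcases hN.2 _ (isSub_range hf) with h | h
  · exact absurd (LinearMap.range_eq_bot.1 h) h0
  · exact LinearMap.range_eq_top.1 h

theorem isSub_map {f : M.carrier →ₗ[K] N.carrier} (hf : IsHom M N f)
    {p : Submodule K M.carrier} (hp : M.IsSub p) : N.IsSub (p.map f) := by
  have := isSub_range ((M.subIncl_isHom p hp).comp hf)
  rwa [LinearMap.range_comp, range_subIncl] at this

theorem IsSimple.of_iso (hM : M.IsSimple) (h : M.Iso N) : N.IsSimple := by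
  obtain ⟨f, hf⟩ := h
  have := hM.1
  refine ⟨f.symm.toEquiv.nontrivial, fun p hp => ?_⟩
  have hker : LinearMap.ker (N.quotMk p hp ∘ₗ f.toLinearMap) = p.comap f.toLinearMap := by
    rw [LinearMap.ker_comp, ker_quotMk]
  have hs := isSub_ker (hf.comp (N.quotMk_isHom p hp))
  rw [hker] at hs
  have hmap : (p.comap f.toLinearMap).map f.toLinearMap = p :=
    Submodule.map_comap_eq_of_surjective f.surjective p
  rcases hM.2 _ hs with h | h
  · left
    rw [← hmap, h, Submodule.map_bot]
  · right
    rw [← hmap, h, Submodule.map_top, LinearEquiv.range]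

/-- A nonzero morphism from a simple comodule to `N`, with values in the sum of the images of
simple comodules `S i`, forces the source to be isomorphic to one of the `S i`. -/
theorem IsSimple.exists_iso_of_range_le {ι : Type*} {S : ι → RightComodule K C}
    (hS : ∀ i, (S i).IsSimple) {g : ∀ i, (S i).carrier →ₗ[K] N.carrier}
    (hg : ∀ i, IsHom (S i) N (g i)) (hM : M.IsSimple) {f : M.carrier →ₗ[K] N.carrier}
    (hf : IsHom M N f) (h0 : f ≠ 0) (hle : LinearMap.range f ≤ ⨆ i, LinearMap.range (g i)) :
    ∃ i, M.Iso (S i) := by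
  classical
  have key : ∀ s : Finset ι, LinearMap.range f ≤ ⨆ i ∈ s, LinearMap.range (g i) →
      ∃ i, M.Iso (S i) := by
    intro s
    induction s using Finset.induction_on with
    | empty =>
      intro h
      exact absurd (LinearMap.range_eq_bot.1 (by simpa using h)) h0
    | insert i s _ ih =>
      intro h
      have hA : N.IsSub (⨆ j ∈ s, LinearMap.range (g j)) :=
        isSub_iSup fun j => isSub_iSup fun _ => isSub_range (hg j)
      -- Modulo the sum `A` of the other images only `S i` remains. If `f` vanishes modulo `A`, the
      -- induction hypothesis applies; otherwise `f` modulo `A` factors through the embedded copy of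
      -- `S i`, and a nonzero morphism between simples is an isomorphism.
      set A := ⨆ j ∈ s, LinearMap.range (g j) with hAdef
      let q := N.quotMk A hA
      have hq : IsHom N (N.quot A hA) q := N.quotMk_isHom A hA
      have hqA : LinearMap.ker q = A := N.ker_quotMk A hA
      by_cases hz : q ∘ₗ f = 0
      · refine ih fun y hy => ?_
        obtain ⟨x, rfl⟩ := hy
        rw [← hqA]
        exact LinearMap.congr_fun hz x
      · have hr : LinearMap.range (q ∘ₗ f) ≤ LinearMap.range (q ∘ₗ g i) := by
          rw [LinearMap.range_comp, LinearMap.range_comp]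
          refine (Submodule.map_mono h).trans ?_
          rw [Finset.iSup_insert, Submodule.map_sup, ← hAdef]
          refine sup_le le_rfl ?_
          rintro _ ⟨y, hy, rfl⟩
          have hy' : q y = 0 := LinearMap.mem_ker.1 (hqA.symm ▸ hy)
          rw [hy']
          exact zero_mem _
        have hgi : q ∘ₗ g i ≠ 0 := by
          intro h'
          rw [h', LinearMap.range_zero, le_bot_iff, LinearMap.range_eq_bot] at hr
          exact hz hr
        have hqg := (hg i).comp hq
        obtain ⟨k, hk, hkf⟩ := (hf.comp hq).exists_lift hqg
          (hqg.injective_of_isSimple (hS i) hgi) hr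
        have hk0 : k ≠ 0 := by
          rintro rfl
          exact hz (by rw [← hkf, LinearMap.comp_zero])
        exact ⟨i, Iso.of_bijective hk ⟨hk.injective_of_isSimple hM hk0,
          hk.surjective_of_isSimple (hS i) hk0⟩⟩
  obtain ⟨x, hx⟩ : ∃ x, f x ≠ 0 := by
    by_contra! h
    exact h0 (LinearMap.ext h)
  -- Reduction to finitely many images: the preimage under `f` of a finite subsum containing `f x`
  -- is a nonzero subcomodule of `M`, hence everything.
  obtain ⟨s, hs⟩ := Submodule.mem_iSup_iff_exists_finset.1 (hle ⟨x, rfl⟩)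
  have hA : N.IsSub (⨆ j ∈ s, LinearMap.range (g j)) :=
    isSub_iSup fun j => isSub_iSup fun _ => isSub_range (hg j)
  refine key s ?_
  have hk := isSub_ker (hf.comp (N.quotMk_isHom _ hA))
  have hmem : ∀ y, y ∈ LinearMap.ker (N.quotMk _ hA ∘ₗ f) ↔
      f y ∈ ⨆ j ∈ s, LinearMap.range (g j) := fun y => by
    rw [LinearMap.ker_comp, ker_quotMk, Submodule.mem_comap]
  rcases hM.2 _ hk with h | h
  · have hx' : x ∈ LinearMap.ker (N.quotMk _ hA ∘ₗ f) := (hmem x).2 hs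
    rw [h, Submodule.mem_bot] at hx'
    exact absurd (by rw [hx', map_zero]) hx
  · rintro _ ⟨y, rfl⟩
    exact (hmem y).1 (h ▸ Submodule.mem_top)

/-! #### Local finiteness -/

/-- The subcomodule `C* x` generated by `x`. -/
noncomputable def span (M : RightComodule K C) (x : M.carrier) : Submodule K M.carrier :=
  LinearMap.range (R := K) (R₂ := K) (M := C →ₗ[K] K) (M₂ := M.carrier) (τ₁₂ := RingHom.id K)
    { toFun := fun f => M.act f x
      map_add' := fun f g => by simp [act, LinearMap.lTensor_add]
      map_smul' := fun a f => by simp [act, LinearMap.lTensor_smul] }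

theorem act_mem_span (M : RightComodule K C) (f : C →ₗ[K] K) (x : M.carrier) :
    M.act f x ∈ M.span x :=
  ⟨f, rfl⟩

theorem act_counit (M : RightComodule K C) (x : M.carrier) : M.act counit x = x := by
  simp only [act, LinearMap.comp_apply, LinearEquiv.coe_coe]
  rw [counit_apply]
  simp

theorem mem_span_self (M : RightComodule K C) (x : M.carrier) : x ∈ M.span x := by
  have := M.act_mem_span counit x
  rwa [act_counit] at this

/-- The slices of `ρ(x)` by functionals on `C` are the elements `f · x`, so they all vanish modulo
`C* x`, and therefore so does `ρ(x)` in `(M / C* x) ⊗ C`. The other elements follow because `ρ(f ·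
x)` is obtained from `ρ(x)` by acting on the factor `C` only. -/
theorem isSub_span (M : RightComodule K C) (x : M.carrier) : M.IsSub (M.span x) := by
  have h : (M.span x).mkQ.rTensor C (M.coact x) = 0 := by
    refine eq_zero_of_forall_lTensor _ fun f => ?_
    rw [← rTensor_lTensor_comm]
    have : f.lTensor M.carrier (M.coact x) = M.act f x ⊗ₜ 1 := by
      apply (TensorProduct.rid K M.carrier).injective
      simp [act]
    rw [this, LinearMap.rTensor_tmul, Submodule.mkQ_apply,
      (Submodule.Quotient.mk_eq_zero _).2 (M.act_mem_span f x), TensorProduct.zero_tmul]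
  rw [isSub_iff]
  rintro _ ⟨f, rfl⟩
  change (M.span x).mkQ.rTensor C (M.coact (M.act f x)) = 0
  rw [coact_act, rTensor_lTensor_comm, h, map_zero]

/-- If `ρ(x) = ∑ mᵢ ⊗ cᵢ` is a finite sum, every `f · x` lies in the span of the `mᵢ`. -/
theorem finiteDimensional_span (M : RightComodule K C) (x : M.carrier) :
    FiniteDimensional K (M.span x) := by
  obtain ⟨s, hs⟩ := TensorProduct.exists_finset (M.coact x)
  have hle : M.span x ≤ Submodule.span K (Prod.fst '' (s : Set (M.carrier × C))) := by
    rintro _ ⟨f, rfl⟩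
    change M.act f x ∈ _
    simp only [act, LinearMap.comp_apply, LinearEquiv.coe_coe, hs, map_sum]
    refine Submodule.sum_mem _ fun i hi => ?_
    simpa using Submodule.smul_mem _ _ (Submodule.subset_span (Set.mem_image_of_mem Prod.fst hi))
  have := FiniteDimensional.span_of_finite K (s.finite_toSet.image Prod.fst)
  exact Submodule.finiteDimensional_of_le hle

theorem IsSimple.finiteDimensional (hM : M.IsSimple) : FiniteDimensional K M.carrier := by
  have := hM.1
  obtain ⟨x, hx⟩ := exists_ne (0 : M.carrier)
  have h := M.finiteDimensional_span x
  rcases hM.2 _ (M.isSub_span x) with h' | h'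
  · have := M.mem_span_self x
    rw [h', Submodule.mem_bot] at this
    exact absurd this hx
  · rw [h'] at h
    exact Module.Finite.equiv Submodule.topEquiv

/-- By local finiteness there are nonzero finite dimensional subcomodules; one of least dimension is
simple. -/
theorem exists_isSimple_sub (M : RightComodule K C) [Nontrivial M.carrier] :
    ∃ (p : Submodule K M.carrier) (hp : M.IsSub p), (M.sub p hp).IsSimple := by
  classical
  obtain ⟨x, hx⟩ := exists_ne (0 : M.carrier)
  have hex : ∃ n, ∃ p : Submodule K M.carrier, M.IsSub p ∧ p ≠ ⊥ ∧ FiniteDimensional K p ∧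
      Module.finrank K p = n := by
    refine ⟨_, M.span x, M.isSub_span x, fun h => ?_, M.finiteDimensional_span x, rfl⟩
    have := M.mem_span_self x
    rw [h, Submodule.mem_bot] at this
    exact hx this
  obtain ⟨p, hp, hp0, hfd, hn⟩ := Nat.find_spec hex
  refine ⟨p, hp, Submodule.nontrivial_iff_ne_bot.2 hp0, fun q hq =>
    or_iff_not_imp_left.2 fun hq0 => ?_⟩
  have hi := M.subIncl_injective p hp
  have hqs := isSub_map (M.subIncl_isHom p hp) hq
  have hle : q.map (M.subIncl p hp) ≤ p := by
    rintro _ ⟨y, -, rfl⟩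
    exact Subtype.property (p := (· ∈ p)) y
  have hmin : Module.finrank K p ≤ Module.finrank K (q.map (M.subIncl p hp)) := by
    rw [hn]
    refine Nat.find_min' hex ⟨_, hqs, fun h => hq0 ?_, Submodule.finiteDimensional_of_le hle, rfl⟩
    exact Submodule.map_injective_of_injective hi (h.trans (Submodule.map_bot _).symm)
  have heq := Submodule.eq_of_le_of_finrank_le hle hmin
  rw [eq_top_iff]
  intro y _
  have hy : M.subIncl p hp y ∈ q.map (M.subIncl p hp) := by
    rw [heq]
    exact Subtype.property (p := (· ∈ p)) y
  obtain ⟨z, hz, hzy⟩ := hy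
  exact hi hzy ▸ hz

end Generalities

end RightComodule

namespace RightComodule

/-! ### Local morphisms and the adjunction between `e(-)` and the section functor -/

section LocalHom

variable {K C : Type u} [Field K] [AddCommGroup C] [Module K C] [Coalgebra K C]
  {e : DualIdempotent K C} {M M' : RightComodule K C} {N N' : RightComodule K e.Corner}

/-- The linear map `φ : M → N` from a right `C`-comodule to a right `eCe`-comodule satisfies
`ρ(φ x) = ∑ φ x₀ ⊗ e x₁ e`; such maps correspond to the morphisms `eM → N`. -/
def IsLocalHom (e : DualIdempotent K C) (M : RightComodule K C) (N : RightComodule K e.Corner)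
    (φ : M.carrier →ₗ[K] N.carrier) : Prop :=
  TensorProduct.map φ e.toCorner ∘ₗ M.coact = N.coact ∘ₗ φ

theorem IsLocalHom.apply {φ : M.carrier →ₗ[K] N.carrier} (hφ : IsLocalHom e M N φ)
    (x : M.carrier) : TensorProduct.map φ e.toCorner (M.coact x) = N.coact (φ x) :=
  LinearMap.congr_fun hφ x

theorem IsLocalHom.comp_isHom {f : M.carrier →ₗ[K] M'.carrier} {φ : M'.carrier →ₗ[K] N.carrier}
    (hφ : IsLocalHom e M' N φ) (hf : IsHom M M' f) : IsLocalHom e M N (φ ∘ₗ f) := by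
  refine LinearMap.ext fun x => ?_
  refine Eq.trans ?_ (hφ.apply (f x))
  rw [← hf.apply, LinearMap.comp_apply, ← LinearMap.map_comp_rTensor, LinearMap.comp_apply]

theorem IsHom.comp_isLocalHom {φ : M.carrier →ₗ[K] N.carrier} {g : N.carrier →ₗ[K] N'.carrier}
    (hg : IsHom N N' g) (hφ : IsLocalHom e M N φ) : IsLocalHom e M N' (g ∘ₗ φ) := by
  refine LinearMap.ext fun x => ?_
  refine Eq.trans ?_ (hg.apply (φ x))
  rw [← hφ.apply, LinearMap.comp_apply, ← LinearMap.comp_apply (LinearMap.rTensor _ _),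
    LinearMap.rTensor_comp_map]

/-- A local morphism to `N'` that factors through a subobject `N` of `N'`. -/
theorem IsLocalHom.of_comp_injective {φ : M.carrier →ₗ[K] N.carrier}
    {g : N.carrier →ₗ[K] N'.carrier} (hg : IsHom N N' g) (hinj : Function.Injective g)
    (h : IsLocalHom e M N' (g ∘ₗ φ)) : IsLocalHom e M N φ := by
  refine LinearMap.ext fun x => ?_
  apply Module.Flat.rTensor_preserves_injective_linearMap (M := e.Corner) _ hinj
  have := h.apply x
  rw [← LinearMap.rTensor_comp_map] at this
  exact this.trans (hg.apply _).symm

/-- The counit of `eCe`, composed with `c ↦ ece`, is `e` itself; applying the counit to the formula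
for `ρ(φ x)` therefore gives `φ x = φ(ex)`. So `φ` is determined by its restriction to `eM`. -/
theorem IsLocalHom.map_act {φ : M.carrier →ₗ[K] N.carrier} (hφ : IsLocalHom e M N φ)
    (x : M.carrier) : φ (M.act e.1.ofConv x) = φ x := by
  have h := N.counit_apply (φ x)
  rw [← hφ.apply] at h
  have h' := (e.lTensor_counit_map φ (M.coact x)).symm.trans h
  rw [e.lTensor_coact, LinearMap.rTensor_tmul] at h'
  simpa using congrArg (TensorProduct.rid K N.carrier) h'

theorem toLocal_isLocalHom (e : DualIdempotent K C) (M : RightComodule K C) :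
    IsLocalHom e M (M.localize e) (M.toLocal e) :=
  LinearMap.ext fun x => (M.localCoact_toLocal e x).symm

theorem IsLocalHom.restrict_isHom {φ : M.carrier →ₗ[K] N.carrier} (hφ : IsLocalHom e M N φ) :
    IsHom (M.localize e) N (φ ∘ₗ (M.localSpace e).subtype) := by
  refine LinearMap.ext fun x => ?_
  refine Eq.trans ?_ (hφ.apply ((M.localSpace e).subtype x))
  change (φ ∘ₗ (M.localSpace e).subtype).rTensor e.Corner
    (TensorProduct.map (M.toLocal e) e.toCorner (M.coact ((M.localSpace e).subtype x))) = _
  rw [← LinearMap.comp_apply (LinearMap.rTensor _ _), LinearMap.rTensor_comp_map]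
  congr 2
  exact LinearMap.ext hφ.map_act

/-- The restriction of `φ` to `eM` has the same image as `φ`, and an element `ex` killed by `φ`
satisfies `ex = e(ex) = 0`. -/
theorem IsLocalHom.localize_iso {φ : M.carrier →ₗ[K] N.carrier} (hφ : IsLocalHom e M N φ)
    (hsurj : Function.Surjective φ) (hker : ∀ x, φ x = 0 → M.act e.1.ofConv x = 0) :
    (M.localize e).Iso N := by
  refine Iso.of_bijective hφ.restrict_isHom ⟨?_, fun y => ?_⟩
  · refine (injective_iff_map_eq_zero _).2 ?_
    rintro ⟨_, x, rfl⟩ hx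
    exact Subtype.ext ((M.act_act e x).symm.trans (hker _ hx))
  · obtain ⟨x, rfl⟩ := hsurj y
    exact ⟨M.toLocal e x, hφ.map_act x⟩

theorem Iso.localize (e : DualIdempotent K C) (h : M.Iso M') :
    (M.localize e).Iso (M'.localize e) := by
  obtain ⟨f, hf⟩ := h
  refine ((toLocal_isLocalHom e M').comp_isHom hf).localize_iso
    ((LinearMap.surjective_rangeRestrict _).comp f.surjective) fun x hx => ?_
  have hx' : M'.act e.1.ofConv (f x) = 0 := congrArg Subtype.val hx
  apply f.injective
  have hact : f (M.act e.1.ofConv x) = M'.act e.1.ofConv (f x) := by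
    have : ∀ t : M.carrier ⊗[K] C, f (TensorProduct.rid K _ (e.1.ofConv.lTensor _ t)) =
        TensorProduct.rid K _ (e.1.ofConv.lTensor _ (f.toLinearMap.rTensor C t)) := by
      intro t
      induction t using TensorProduct.induction_on with
      | zero => simp
      | add a b ha hb => simp only [map_add, ha, hb]
      | tmul a c => simp
    refine (this _).trans ?_
    rw [hf.apply]
    rfl
  rw [hact, hx', map_zero]

/-- The map `M → N ⊗ C`, `x ↦ ∑ φ x₀ ⊗ x₁`. -/
noncomputable def toCofree (M : RightComodule K C) {V : Type u} [AddCommGroup V] [Module K V]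
    (φ : M.carrier →ₗ[K] V) : M.carrier →ₗ[K] V ⊗[K] C :=
  φ.rTensor C ∘ₗ M.coact

theorem map_coact {V W : Type u} [AddCommGroup V] [Module K V] [AddCommGroup W] [Module K W]
    (φ : M.carrier →ₗ[K] V) (g : C →ₗ[K] W) (x : M.carrier) :
    TensorProduct.map φ g (M.coact x) = g.lTensor V (M.toCofree φ x) := by
  rw [toCofree, LinearMap.comp_apply, ← LinearMap.comp_apply (LinearMap.lTensor _ _),
    LinearMap.lTensor_comp_rTensor]

theorem toCofree_comp {V W : Type u} [AddCommGroup V] [Module K V] [AddCommGroup W] [Module K W]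
    (φ : M.carrier →ₗ[K] V) (g : V →ₗ[K] W) :
    M.toCofree (g ∘ₗ φ) = g.rTensor C ∘ₗ M.toCofree φ := by
  rw [toCofree, toCofree, LinearMap.rTensor_comp, LinearMap.comp_assoc]

theorem IsHom.toCofree_comp {f : M.carrier →ₗ[K] M'.carrier} (hf : IsHom M M' f)
    {V : Type u} [AddCommGroup V] [Module K V] (φ : M'.carrier →ₗ[K] V) :
    M.toCofree (φ ∘ₗ f) = M'.toCofree φ ∘ₗ f := by
  rw [toCofree, toCofree, LinearMap.rTensor_comp, LinearMap.comp_assoc, hf, LinearMap.comp_assoc]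

theorem lTensor_counit_toCofree {V : Type u} [AddCommGroup V] [Module K V]
    (φ : M.carrier →ₗ[K] V) (x : M.carrier) :
    (counit (R := K) (A := C)).lTensor V (M.toCofree φ x) = φ x ⊗ₜ 1 := by
  rw [toCofree, LinearMap.comp_apply, ← rTensor_lTensor_comm, counit_apply,
    LinearMap.rTensor_tmul]

/-- Applying the counit to the factor `C` recovers `φ x` from `toCofree φ x`. -/
theorem map_eq_zero_of_toCofree {V : Type u} [AddCommGroup V] [Module K V]
    {φ : M.carrier →ₗ[K] V} {x : M.carrier} (h : M.toCofree φ x = 0) : φ x = 0 := by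
  have h' := lTensor_counit_toCofree φ x
  rw [h, map_zero] at h'
  simpa using congrArg (TensorProduct.rid K V) h'.symm

/-- This is coassociativity. Consequently the kernel of `toCofree φ` is a subcomodule, in fact the
largest one inside `ker φ`. -/
theorem toCofree_isHom {V : Type u} [AddCommGroup V] [Module K V] (φ : M.carrier →ₗ[K] V) :
    IsHom M (tensorLeft V (regular K C)) (M.toCofree φ) := by
  refine LinearMap.ext fun x => ?_
  change (φ.rTensor C ∘ₗ M.coact).rTensor C (M.coact x) =
    (TensorProduct.assoc K V C C).symm (comul.lTensor V (φ.rTensor C (M.coact x)))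
  rw [LinearEquiv.eq_symm_apply, LinearMap.rTensor_comp_apply, assoc_rTensor_rTensor,
    coassoc_apply, rTensor_lTensor_comm]

theorem isSub_ker_toCofree {V : Type u} [AddCommGroup V] [Module K V]
    (φ : M.carrier →ₗ[K] V) : M.IsSub (LinearMap.ker (M.toCofree φ)) :=
  isSub_ker (toCofree_isHom φ)

/-- Since `φ(ex) = φ x`, and `e` acting on the `M`-factor of `ρ(x)` is the same as `e` acting from
the right on the `C`-factor, the values of `toCofree φ` already lie in `N ⊗ Ce`. -/
theorem IsLocalHom.lTensor_dualRight_toCofree {φ : M.carrier →ₗ[K] N.carrier}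
    (hφ : IsLocalHom e M N φ) (x : M.carrier) :
    (dualRight e.1.ofConv).lTensor N.carrier (M.toCofree φ x) = M.toCofree φ x := by
  rw [toCofree, LinearMap.comp_apply, ← rTensor_lTensor_comm, ← act_coact,
    ← LinearMap.rTensor_comp_apply]
  congr 2
  exact LinearMap.ext hφ.map_act

/-- `∑ φ (e x)₀ ⊗ (e x)₁ = ρ(φ x)` for a local morphism `φ`. -/
theorem IsLocalHom.toCofree_act {φ : M.carrier →ₗ[K] N.carrier}
    (hφ : IsLocalHom e M N φ) (x : M.carrier) :
    M.toCofree φ (M.act e.1.ofConv x) =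
      e.Corner.subtype.lTensor N.carrier (N.coact (φ x)) := by
  rw [← hφ.apply]
  have h := hφ.lTensor_dualRight_toCofree x
  have h1 : M.toCofree φ (M.act e.1.ofConv x) =
      (dualLeft e.1.ofConv).lTensor N.carrier (M.toCofree φ x) := by
    rw [toCofree, LinearMap.comp_apply, coact_act, rTensor_lTensor_comm]
    rfl
  rw [h1, ← h, ← LinearMap.lTensor_comp_apply, toCofree, LinearMap.comp_apply,
    ← LinearMap.comp_apply (LinearMap.lTensor _ _), ← LinearMap.comp_apply (LinearMap.lTensor _ _),
    LinearMap.lTensor_comp_rTensor, LinearMap.lTensor_comp_map]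
  rfl

/-- The morphism `M → N □ Ce` corresponding to a local morphism `φ : M → N`. -/
theorem IsLocalHom.exists_section {φ : M.carrier →ₗ[K] N.carrier} (hφ : IsLocalHom e M N φ) :
    ∃ f : M.carrier →ₗ[K] (section_ e N).carrier, IsHom M (section_ e N) f ∧
      LinearMap.ker f = LinearMap.ker (M.toCofree φ) := by
  let f : M.carrier →ₗ[K] (tensorLeft N.carrier e.rightIdeal).carrier :=
    e.toRightIdeal.lTensor N.carrier ∘ₗ M.toCofree φ
  have hhom : IsHom (regular K C) e.rightIdeal e.toRightIdeal :=
    LinearMap.ext fun x => (e.coact_toRightIdeal x).symm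
  have hf : IsHom M (tensorLeft N.carrier e.rightIdeal) f :=
    (toCofree_isHom φ).comp (hhom.lTensor N.carrier)
  have hincl : ∀ t : N.carrier ⊗[K] C, e.rightIdealIncl.lTensor N.carrier
      (e.toRightIdeal.lTensor N.carrier t) = (dualRight e.1.ofConv).lTensor N.carrier t := by
    intro t
    rw [← LinearMap.lTensor_comp_apply]
    rfl
  -- Projecting from `N ⊗ C` to `N ⊗ Ce` loses nothing, because `toCofree φ` takes values in `N ⊗
  -- Ce`.
  have hker : LinearMap.ker f = LinearMap.ker (M.toCofree φ) := by
    ext x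
    refine ⟨fun h => ?_, fun h => ?_⟩
    · rw [LinearMap.mem_ker, ← hφ.lTensor_dualRight_toCofree x, ← hincl]
      exact (congrArg _ (LinearMap.mem_ker.1 h)).trans (map_zero _)
    · rw [LinearMap.mem_ker]
      exact (congrArg (e.toRightIdeal.lTensor N.carrier) (LinearMap.mem_ker.1 h)).trans
        (map_zero _)
  have hrange : LinearMap.range f ≤ LinearMap.range
      ((tensorLeft N.carrier e.rightIdeal).subIncl (LinearMap.ker (cotensorMap e N))
        (isSub_ker (cotensorMap_isHom e N))) := by
    rw [range_subIncl]
    rintro _ ⟨x, rfl⟩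
    rw [LinearMap.mem_ker]
    change TensorProduct.assoc K N.carrier e.Corner e.rightIdeal.carrier
      (N.coact.rTensor e.rightIdeal.carrier (e.toRightIdeal.lTensor N.carrier
        (φ.rTensor C (M.coact x)))) -
      e.leftCoact.lTensor N.carrier (e.toRightIdeal.lTensor N.carrier
        (φ.rTensor C (M.coact x))) = 0
    -- The two terms of the cotensor equation are the images of the two sides of coassociativity of
    -- `M` under one and the same map.
    have h1 : ∀ t : M.carrier ⊗[K] C,
        TensorProduct.assoc K N.carrier e.Corner e.rightIdeal.carrier
          (N.coact.rTensor e.rightIdeal.carrier (e.toRightIdeal.lTensor N.carrier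
            (φ.rTensor C t))) =
        TensorProduct.map φ (TensorProduct.map e.toCorner e.toRightIdeal)
          (TensorProduct.assoc K M.carrier C C (M.coact.rTensor C t)) := by
      intro t
      induction t using TensorProduct.induction_on with
      | zero => simp
      | add a b ha hb => simp only [map_add, ha, hb]
      | tmul a c =>
        simp only [LinearMap.rTensor_tmul, LinearMap.lTensor_tmul, ← hφ.apply]
        induction M.coact a using TensorProduct.induction_on with
        | zero => simp
        | add a b ha hb => simp only [TensorProduct.add_tmul, map_add, ha, hb]
        | tmul a c => simp
    have h2 : ∀ t : M.carrier ⊗[K] C,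
        e.leftCoact.lTensor N.carrier (e.toRightIdeal.lTensor N.carrier (φ.rTensor C t)) =
        TensorProduct.map φ (TensorProduct.map e.toCorner e.toRightIdeal)
          ((comul (R := K) (A := C)).lTensor M.carrier t) := by
      intro t
      induction t using TensorProduct.induction_on with
      | zero => simp
      | add a b ha hb => simp only [map_add, ha, hb]
      | tmul a c => simp [e.leftCoact_toRightIdeal]
    rw [h1, h2, coassoc_apply, sub_self]
  obtain ⟨k, hk, hkf⟩ := hf.exists_lift (subIncl_isHom _ _ _) (subIncl_injective _ _ _) hrange
  refine ⟨k, hk, ?_⟩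
  rw [← hker, ← hkf]
  exact (LinearMap.ker_comp_of_ker_eq_bot _
    (LinearMap.ker_eq_bot.2 (subIncl_injective _ _ _))).symm

end LocalHom

end RightComodule

/-! ### The counit `S(N) → N` and the transfer of indecomposability -/

section Model

variable {K C : Type u} [Field K] [AddCommGroup C] [Module K C] [Coalgebra K C]
  {e : DualIdempotent K C}

theorem DualIdempotent.counit_dualRight (e : DualIdempotent K C) (c : C) :
    counit (R := K) (dualRight e.1.ofConv c) = e.1.ofConv c := by
  have h := congrArg (fun t => e.1.ofConv (TensorProduct.rid K C t))
    (Coalgebra.lTensor_counit_comul (R := K) c)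
  refine Eq.trans ?_ (h.trans ?_)
  · simp only [dualRight, LinearMap.comp_apply, LinearEquiv.coe_coe]
    induction (comul (R := K) c) using TensorProduct.induction_on with
    | zero => simp
    | add a b ha hb => simp only [map_add, ha, hb]
    | tmul a c => simp [mul_comm]
  · simp

theorem DualIdempotent.rightIdealIncl_toRightIdeal (e : DualIdempotent K C) (c : C) :
    e.rightIdealIncl (e.toRightIdeal c) = dualRight e.1.ofConv c :=
  rfl

/-- As `ε(ce) = e(c)`, contracting the second factor of `∑ e c₁ e ⊗ c₂ e` leaves `e(ec)e = ece`. -/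
theorem DualIdempotent.rid_counit_leftCoact (e : DualIdempotent K C) (y : e.rightIdeal.carrier) :
    TensorProduct.rid K e.Corner ((counit ∘ₗ e.rightIdealIncl).lTensor e.Corner
      (e.leftCoact y)) = e.toCorner (e.rightIdealIncl y) := by
  obtain ⟨c, rfl⟩ : ∃ c, e.toRightIdeal c = y := LinearMap.surjective_rangeRestrict _ y
  have h1 : e.toCorner (e.rightIdealIncl (e.toRightIdeal c)) =
      e.toCorner (dualLeft e.1.ofConv c) :=
    (LinearMap.congr_fun e.toCorner_dualRight c).trans
      (LinearMap.congr_fun e.toCorner_dualLeft c).symm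
  rw [e.leftCoact_toRightIdeal, h1, dualLeft, LinearMap.comp_apply, LinearMap.comp_apply]
  induction (comul (R := K) c) using TensorProduct.induction_on with
  | zero => simp
  | add a b ha hb => simp only [map_add, ha, hb]
  | tmul a c => simp [e.rightIdealIncl_toRightIdeal, e.counit_dualRight]

theorem DualIdempotent.dualLeft_coe (e : DualIdempotent K C) (y : e.Corner) :
    dualLeft e.1.ofConv (y : C) = y := by
  obtain ⟨_, c, rfl⟩ := y
  exact dualLeft_dualLeft e _

theorem DualIdempotent.dualRight_coe (e : DualIdempotent K C) (y : e.Corner) :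
    dualRight e.1.ofConv (y : C) = y := by
  obtain ⟨_, c, rfl⟩ := y
  change dualRight e.1.ofConv (dualLeft e.1.ofConv (dualRight e.1.ofConv c)) =
    dualLeft e.1.ofConv (dualRight e.1.ofConv c)
  rw [← dualLeft_dualRight, dualRight_dualRight]

/-- The inclusion `eCe → Ce`. -/
noncomputable def DualIdempotent.cornerToRightIdeal (e : DualIdempotent K C) :
    e.Corner →ₗ[K] e.rightIdeal.carrier :=
  e.toRightIdeal ∘ₗ e.Corner.subtype

/-- The left coaction of `Ce` extends the comultiplication of `eCe`; this turns coassociativity of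
`N` into the statement that `ρ(n)` lies in `N □ Ce`. -/
theorem DualIdempotent.leftCoact_cornerToRightIdeal (e : DualIdempotent K C) (y : e.Corner) :
    e.leftCoact (e.cornerToRightIdeal y) =
      e.cornerToRightIdeal.lTensor e.Corner (comul (R := K) y) := by
  have h1 : e.cornerToRightIdeal ∘ₗ e.toCorner = e.toRightIdeal ∘ₗ dualLeft e.1.ofConv := by
    ext c
    apply Subtype.ext
    change dualRight e.1.ofConv (dualLeft e.1.ofConv (dualRight e.1.ofConv c)) =
      dualRight e.1.ofConv (dualLeft e.1.ofConv c)
    rw [dualLeft_dualRight, dualRight_dualRight]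
  change e.leftCoact (e.toRightIdeal (y : C)) = e.cornerToRightIdeal.lTensor e.Corner
    (TensorProduct.map e.toCorner e.toCorner (comul (y : C)))
  rw [e.leftCoact_toRightIdeal, ← LinearMap.comp_apply (LinearMap.lTensor _ _),
    LinearMap.lTensor_comp_map, h1, ← LinearMap.map_comp_lTensor, LinearMap.comp_apply,
    ← comul_dualLeft, e.dualLeft_coe]

namespace RightComodule

/-- The counit of the adjunction: a local morphism `φ : N □ Ce → N`, `∑ n ⊗ c ↦ ∑ n ε(c)`. -/
theorem exists_isLocalHom_section (N : RightComodule K e.Corner) :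
    ∃ φ : (section_ e N).carrier →ₗ[K] N.carrier, IsLocalHom e (section_ e N) N φ ∧
      Function.Surjective φ ∧ Function.Injective ((section_ e N).toCofree φ) := by
  let ψ : N.carrier ⊗[K] e.rightIdeal.carrier →ₗ[K] N.carrier :=
    (TensorProduct.rid K N.carrier).toLinearMap ∘ₗ
      (counit ∘ₗ e.rightIdealIncl).lTensor N.carrier
  let ψ' : (tensorLeft N.carrier e.rightIdeal).carrier →ₗ[K] N.carrier := ψ
  let i : (section_ e N).carrier →ₗ[K] (tensorLeft N.carrier e.rightIdeal).carrier :=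
    (tensorLeft N.carrier e.rightIdeal).subIncl (LinearMap.ker (cotensorMap e N))
    (isSub_ker (cotensorMap_isHom e N))
  have hi : IsHom (section_ e N) _ i := subIncl_isHom _ _ _
  have hinj : Function.Injective i := subIncl_injective _ _ _
  have hr : LinearMap.range i = LinearMap.ker (cotensorMap e N) := range_subIncl _ _ _
  -- By the counit law, `toCofree` of `n ⊗ c ↦ ε(c) n` is the inclusion `N ⊗ Ce → N ⊗ C`; this gives
  -- the injectivity claimed at the end.
  have hψ : ∀ t : N.carrier ⊗[K] e.rightIdeal.carrier,
      (tensorLeft N.carrier e.rightIdeal).toCofree ψ' t = e.rightIdealIncl.lTensor N.carrier t := by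
    intro t
    change ψ.rTensor C ((TensorProduct.assoc K N.carrier e.rightIdeal.carrier C).symm
      (e.rightIdeal.coact.lTensor N.carrier t)) = _
    induction t using TensorProduct.induction_on with
    | zero => simp
    | add a b ha hb => simp only [map_add, ha, hb]
    | tmul n y =>
      have hy : e.rightIdealIncl.rTensor C (e.rightIdeal.coact y) =
          comul (R := K) (e.rightIdealIncl y) :=
        (subIncl_isHom (regular K C) _ e.isSub_rightIdealSpace).apply y
      have h := congrArg (fun t => n ⊗ₜ[K] TensorProduct.lid K C t)
        (Coalgebra.rTensor_counit_comul (R := K) (e.rightIdealIncl y))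
      simp only [← hy, TensorProduct.lid_tmul, one_smul] at h
      rw [LinearMap.lTensor_tmul, LinearMap.lTensor_tmul, ← h]
      generalize e.rightIdeal.coact y = s
      induction s using TensorProduct.induction_on with
      | zero => simp
      | add a b ha hb => simp only [TensorProduct.tmul_add, map_add, ha, hb]
      | tmul a c => simp [ψ, TensorProduct.smul_tmul]
  have hcof : ∀ x, (section_ e N).toCofree (ψ' ∘ₗ i) x = e.rightIdealIncl.lTensor N.carrier (i x) :=
    fun x => (LinearMap.congr_fun (hi.toCofree_comp ψ') x).trans (hψ _)
  refine ⟨ψ' ∘ₗ i, LinearMap.ext fun x => ?_, fun n => ?_, fun x y hxy => ?_⟩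
  -- Contracting the last factor of the cotensor equation with `ε` turns one side into `ρ(φ x)` and
  -- the other into `∑ φ x₀ ⊗ e x₁ e`.
  · have hx : cotensorMap e N (i x) = 0 := LinearMap.mem_ker.1 (hr.le (LinearMap.mem_range_self i x))
    have h1 : TensorProduct.assoc K N.carrier e.Corner e.rightIdeal.carrier
        (N.coact.rTensor e.rightIdeal.carrier (i x)) = e.leftCoact.lTensor N.carrier (i x) :=
      sub_eq_zero.1 hx
    have h2 := congrArg (((TensorProduct.rid K e.Corner).toLinearMap ∘ₗ
      (counit ∘ₗ e.rightIdealIncl).lTensor e.Corner).lTensor N.carrier) h1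
    have h3 : ∀ t : N.carrier ⊗[K] e.rightIdeal.carrier,
        ((TensorProduct.rid K e.Corner).toLinearMap ∘ₗ
          (counit ∘ₗ e.rightIdealIncl).lTensor e.Corner).lTensor N.carrier
          (TensorProduct.assoc K N.carrier e.Corner e.rightIdeal.carrier
            (N.coact.rTensor e.rightIdeal.carrier t)) = N.coact (ψ t) := by
      intro t
      induction t using TensorProduct.induction_on with
      | zero => simp
      | add a b ha hb => simp only [map_add, ha, hb]
      | tmul n y =>
        have : ψ (n ⊗ₜ y) = counit (R := K) (e.rightIdealIncl y) • n := by simp [ψ]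
        rw [this, map_smul, LinearMap.rTensor_tmul]
        generalize N.coact n = s
        induction s using TensorProduct.induction_on with
        | zero => simp
        | add a b ha hb => simp only [TensorProduct.add_tmul, map_add, ha, hb, smul_add]
        | tmul a c => simp
    have h4 : ∀ t : N.carrier ⊗[K] e.rightIdeal.carrier,
        ((TensorProduct.rid K e.Corner).toLinearMap ∘ₗ
          (counit ∘ₗ e.rightIdealIncl).lTensor e.Corner).lTensor N.carrier
          (e.leftCoact.lTensor N.carrier t) =
        e.toCorner.lTensor N.carrier (e.rightIdealIncl.lTensor N.carrier t) := by
      intro t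
      rw [← LinearMap.lTensor_comp_apply, ← LinearMap.lTensor_comp_apply]
      congr 2
      exact LinearMap.ext e.rid_counit_leftCoact
    refine Eq.trans ?_ ((h3 _).symm.trans (h2.trans (h4 _))).symm
    rw [← hcof]
    exact map_coact _ _ _
  -- The preimage of `n` is `ρ(n)`, viewed in `N ⊗ Ce`; the counit law of `N` sends it back to `n`.
  · have hmem : cotensorMap e N (e.cornerToRightIdeal.lTensor N.carrier (N.coact n)) = 0 := by
      refine sub_eq_zero.2 ?_
      change TensorProduct.assoc K N.carrier e.Corner e.rightIdeal.carrier
        (N.coact.rTensor e.rightIdeal.carrier (e.cornerToRightIdeal.lTensor N.carrier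
          (N.coact n))) = e.leftCoact.lTensor N.carrier (e.cornerToRightIdeal.lTensor N.carrier
          (N.coact n))
      have h1 : e.leftCoact ∘ₗ e.cornerToRightIdeal =
          e.cornerToRightIdeal.lTensor e.Corner ∘ₗ comul :=
        LinearMap.ext e.leftCoact_cornerToRightIdeal
      have h2 : ∀ t : (N.carrier ⊗[K] e.Corner) ⊗[K] e.Corner,
          TensorProduct.assoc K N.carrier e.Corner e.rightIdeal.carrier
            (e.cornerToRightIdeal.lTensor (N.carrier ⊗[K] e.Corner) t) =
          (e.cornerToRightIdeal.lTensor e.Corner).lTensor N.carrier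
            (TensorProduct.assoc K N.carrier e.Corner e.Corner t) := by
        intro t
        induction t using TensorProduct.induction_on with
        | zero => simp
        | add a b ha hb => simp only [map_add, ha, hb]
        | tmul t c =>
          induction t using TensorProduct.induction_on with
          | zero => simp
          | add a b ha hb => simp only [TensorProduct.add_tmul, map_add, ha, hb]
          | tmul a b => simp
      rw [← LinearMap.lTensor_comp_apply, h1, LinearMap.lTensor_comp_apply, ← coassoc_apply, ← h2,
        rTensor_lTensor_comm]
    obtain ⟨x, hx⟩ : ∃ x, i x = e.cornerToRightIdeal.lTensor N.carrier (N.coact n) :=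
      hr.ge (LinearMap.mem_ker.2 hmem)
    refine ⟨x, ?_⟩
    have h3 : (counit ∘ₗ e.rightIdealIncl) ∘ₗ e.cornerToRightIdeal =
        counit (R := K) (A := e.Corner) := by
      ext y
      change counit (R := K) (dualRight e.1.ofConv (y : C)) = counit (R := K) (y : C)
      rw [e.dualRight_coe]
    change TensorProduct.rid K N.carrier
      ((counit ∘ₗ e.rightIdealIncl).lTensor N.carrier (i x)) = n
    rw [hx, ← LinearMap.lTensor_comp_apply, h3, counit_apply]
    simp
  · rw [hcof, hcof] at hxy
    refine hinj (Module.Flat.lTensor_preserves_injective_linearMap (M := N.carrier)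
      e.rightIdealIncl ?_ hxy)
    exact e.rightIdealSpace.injective_subtype

variable {M : RightComodule K C} {N : RightComodule K e.Corner} {φ : M.carrier →ₗ[K] N.carrier}

/-- The value of `toCofree φ` at `ex` is `ρ(φ x)`, which depends only on `φ x`. -/
theorem IsLocalHom.act_eq_zero (hφ : IsLocalHom e M N φ)
    (hinj : Function.Injective (M.toCofree φ)) {x : M.carrier} (hx : φ x = 0) :
    M.act e.1.ofConv x = 0 := by
  apply hinj
  rw [hφ.toCofree_act, hx, map_zero, map_zero, map_zero]

theorem IsLocalHom.isSub_map (hφ : IsLocalHom e M N φ) {p : Submodule K M.carrier}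
    (hp : M.IsSub p) : N.IsSub (p.map φ) := by
  rintro _ ⟨x, hx, rfl⟩
  obtain ⟨t, ht⟩ := hp x hx
  let φ' : p →ₗ[K] p.map φ := φ.submoduleMap p
  refine ⟨TensorProduct.map φ' e.toCorner t, ?_⟩
  rw [← hφ.apply, ← ht, ← LinearMap.comp_apply (LinearMap.rTensor _ _), LinearMap.rTensor_comp_map,
    ← LinearMap.comp_apply (TensorProduct.map _ _), LinearMap.map_comp_rTensor]
  rfl

/-- For `x` in a subcomodule inside `ker φ`, all `x₀` lie in `ker φ`, so `toCofree φ x = 0`. -/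
theorem eq_bot_of_forall_map_eq_zero (hinj : Function.Injective (M.toCofree φ))
    {p : Submodule K M.carrier} (hp : M.IsSub p) (h : ∀ x ∈ p, φ x = 0) : p = ⊥ := by
  refine (Submodule.eq_bot_iff _).2 fun x hx => hinj ?_
  obtain ⟨t, ht⟩ := hp x hx
  have h0 : φ ∘ₗ p.subtype = 0 := LinearMap.ext fun y => h y y.2
  rw [map_zero, toCofree, LinearMap.comp_apply, ← ht, ← LinearMap.rTensor_comp_apply, h0,
    LinearMap.rTensor_zero, LinearMap.zero_apply]

/-- A decomposition `M = p ⊕ q` induces `N = φ(p) ⊕ φ(q)`: if `φ a = φ b` with `a ∈ p` and `b ∈ q`,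
then `ea = eb` lies in `p ∩ q = 0`, so `φ a = φ(ea) = 0`. One of the images vanishes, and a nonzero
subcomodule of `M` cannot be killed by `φ`. -/
theorem IsLocalHom.isIndecomposable (hφ : IsLocalHom e M N φ) (hsurj : Function.Surjective φ)
    (hinj : Function.Injective (M.toCofree φ)) (hN : N.IsIndecomposable) :
    M.IsIndecomposable := by
  have := hN.1
  refine ⟨hsurj.nontrivial, fun p q hp hq hpq => ?_⟩
  have hc : IsCompl (p.map φ) (q.map φ) := by
    refine ⟨?_, ?_⟩
    · rw [Submodule.disjoint_def]
      rintro _ ⟨a, ha, rfl⟩ ⟨b, hb, hab⟩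
      have h1 := hφ.act_eq_zero hinj (x := b - a) (by rw [map_sub, hab, sub_self])
      rw [map_sub, sub_eq_zero] at h1
      have h2 : M.act e.1.ofConv a = 0 :=
        Submodule.disjoint_def.1 hpq.disjoint _ (isSub_act hp _ ha) (h1 ▸ isSub_act hq _ hb)
      rw [← hφ.map_act, h2, map_zero]
    · rw [codisjoint_iff, ← Submodule.map_sup, hpq.sup_eq_top, Submodule.map_top,
        LinearMap.range_eq_top.2 hsurj]
  have hz : ∀ p : Submodule K M.carrier, M.IsSub p → p.map φ = ⊥ → p = ⊥ := fun p hp h =>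
    eq_bot_of_forall_map_eq_zero hinj hp fun x hx =>
      (Submodule.mem_bot K).1 (h ▸ Submodule.mem_map_of_mem hx)
  exact (hN.2 _ _ (hφ.isSub_map hp) (hφ.isSub_map hq) hc).imp (hz p hp) (hz q hq)

end RightComodule

end Model

namespace RightComodule

/-! ### Pulling back composition series along a local morphism -/

section Filtration

variable {K C : Type u} [Field K] [AddCommGroup C] [Module K C] [Coalgebra K C]
  {e : DualIdempotent K C} {M : RightComodule K C} {N : RightComodule K e.Corner}
  {φ : M.carrier →ₗ[K] N.carrier}

/-- Simple comodules are finite dimensional, and finite dimensionality passes through extensions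
along the series. -/
theorem CompSeries.finiteDimensional (s : M.CompSeries) : FiniteDimensional K M.carrier := by
  have key : ∀ j, FiniteDimensional K (s.F j) := by
    intro j
    induction j using Fin.induction with
    | zero => rw [s.zero]; infer_instance
    | succ j ih =>
      let p : Submodule K (M.sub _ (s.isSub j.succ)).carrier :=
        (s.F j.castSucc).comap (M.subIncl _ (s.isSub j.succ))
      have h1 : FiniteDimensional K ((M.sub _ (s.isSub j.succ)).carrier ⧸ p) :=
        (s.simple j).finiteDimensional
      have h2 : FiniteDimensional K p :=
        Module.Finite.equiv (Submodule.comapSubtypeEquivOfLe (s.le j)).symm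
      exact @Module.Finite.of_submodule_quotient _ _ _ _ _ p h2 h1
  have h := key (Fin.last s.n)
  rw [s.last] at h
  exact Module.Finite.equiv Submodule.topEquiv

/-- The largest subcomodule of `M` that `φ` maps to `F`: `{x | ∑ φ x₀ ⊗ x₁ ∈ F ⊗ C}`. -/
noncomputable def pullback (φ : M.carrier →ₗ[K] N.carrier) (F : Submodule K N.carrier) :
    Submodule K M.carrier :=
  LinearMap.ker (M.toCofree (F.mkQ ∘ₗ φ))

theorem isSub_pullback (φ : M.carrier →ₗ[K] N.carrier) (F : Submodule K N.carrier) :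
    M.IsSub (pullback φ F) :=
  isSub_ker_toCofree _

theorem pullback_mono (φ : M.carrier →ₗ[K] N.carrier) {p q : Submodule K N.carrier}
    (h : p ≤ q) : pullback φ p ≤ pullback φ q := by
  intro x hx
  have hq : q.mkQ ∘ₗ φ = Submodule.factor h ∘ₗ p.mkQ ∘ₗ φ := by
    ext
    simp
  rw [pullback, LinearMap.mem_ker] at hx ⊢
  rw [hq, toCofree_comp, LinearMap.comp_apply, hx, map_zero]

theorem pullback_top (φ : M.carrier →ₗ[K] N.carrier) : pullback φ ⊤ = ⊤ := by
  have h : (⊤ : Submodule K N.carrier).mkQ ∘ₗ φ = 0 := by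
    ext x
    exact (Submodule.Quotient.mk_eq_zero _).2 Submodule.mem_top
  rw [pullback, h, LinearMap.ker_eq_top, toCofree, LinearMap.rTensor_zero, LinearMap.zero_comp]

theorem pullback_bot (hinj : Function.Injective (M.toCofree φ)) : pullback φ ⊥ = ⊥ := by
  rw [pullback, LinearMap.ker_eq_bot, toCofree_comp]
  refine (Module.Flat.rTensor_preserves_injective_linearMap (M := C)
    (⊥ : Submodule K N.carrier).mkQ ?_).comp hinj
  rw [← LinearMap.ker_eq_bot, Submodule.ker_mkQ]

theorem map_mem_of_mem_pullback {F : Submodule K N.carrier} {x : M.carrier}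
    (hx : x ∈ pullback φ F) : φ x ∈ F :=
  (Submodule.Quotient.mk_eq_zero F).1 (map_eq_zero_of_toCofree (φ := F.mkQ ∘ₗ φ) hx)

/-- `toCofree φ` sends `ex` to `ρ(φ x)`, which lies in `F ⊗ C`. For surjective `φ`, this makes `φ`
map the pullback of `F` onto `F`. -/
theorem IsLocalHom.act_mem_pullback (hφ : IsLocalHom e M N φ) {F : Submodule K N.carrier}
    (hF : N.IsSub F) {x : M.carrier} (hx : φ x ∈ F) : M.act e.1.ofConv x ∈ pullback φ F := by
  rw [pullback, LinearMap.mem_ker, toCofree_comp, LinearMap.comp_apply, hφ.toCofree_act,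
    rTensor_lTensor_comm, (N.isSub_iff F).1 hF _ hx, map_zero]

/-- Left exactness of the section functor: the pullback of `q` maps to `S(q/p) ≅ S(T) ≅ S`, with
kernel exactly the pullback of `p`. The map is nonzero because the local morphism to `T ≠ 0` is
onto, so it is surjective by simplicity of `S`. -/
theorem IsLocalHom.subquot_pullback_iso (hφ : IsLocalHom e M N φ)
    (hsurj : Function.Surjective φ) {p q : Submodule K N.carrier} (hp : N.IsSub p)
    (hq : N.IsSub q) (hpq : p ≤ q) (hsimple : (N.subquot p q hp hq hpq).IsSimple)
    {T : RightComodule K e.Corner} (hT : (N.subquot p q hp hq hpq).Iso T)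
    {S : RightComodule K C} (hS : S.IsSimple) (hTS : (section_ e T).Iso S) :
    (M.subquot (pullback φ p) (pullback φ q) (isSub_pullback φ p) (isSub_pullback φ q)
      (pullback_mono φ hpq)).Iso S := by
  have hTs := (hsimple.of_iso hT).1
  obtain ⟨f, hf⟩ := hT
  obtain ⟨g, hg⟩ := hTS
  let A := M.sub (pullback φ q) (isSub_pullback φ q)
  let i : A.carrier →ₗ[K] M.carrier := M.subIncl (pullback φ q) (isSub_pullback φ q)
  have hi : IsHom A M i := M.subIncl_isHom _ _
  have hmem : ∀ x, i x ∈ pullback φ q := fun x => Subtype.property (p := (· ∈ pullback φ q)) x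
  let φq : A.carrier →ₗ[K] (N.sub q hq).carrier :=
    (φ ∘ₗ i).codRestrict q fun x =>
      show φ (i x) ∈ q from map_mem_of_mem_pullback (hmem x)
  have hφq : IsLocalHom e A (N.sub q hq) φq :=
    IsLocalHom.of_comp_injective (N.subIncl_isHom q hq) (N.subIncl_injective q hq)
      (hφ.comp_isHom hi)
  let π : (N.sub q hq).carrier →ₗ[K] (N.subquot p q hp hq hpq).carrier := quotMk _ _ _
  have hπ : IsHom (N.sub q hq) (N.subquot p q hp hq hpq) π := quotMk_isHom _ _ _
  have hφqs : Function.Surjective φq := by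
    intro y
    obtain ⟨x, hx⟩ := hsurj (N.subIncl q hq y)
    have hxq : φ x ∈ q := hx ▸ Subtype.property (p := (· ∈ q)) y
    -- The chosen preimage `x` need not lie in the pullback of `q`, but `ex` does and has the same
    -- image.
    refine ⟨(⟨M.act e.1.ofConv x, hφ.act_mem_pullback hq hxq⟩ : pullback φ q), ?_⟩
    apply N.subIncl_injective q hq
    exact (hφ.map_act x).trans hx
  have hψ : IsLocalHom e A T (f.toLinearMap ∘ₗ π ∘ₗ φq) :=
    hf.comp_isLocalHom (hπ.comp_isLocalHom hφq)
  have hψs : Function.Surjective (f.toLinearMap ∘ₗ π ∘ₗ φq) :=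
    f.surjective.comp ((quotMk_surjective _ _ _).comp hφqs)
  obtain ⟨k, hk, hker⟩ := hψ.exists_section
  have hker' : LinearMap.ker (g.toLinearMap ∘ₗ k) =
      LinearMap.ker (A.toCofree (f.toLinearMap ∘ₗ π ∘ₗ φq)) := by
    rw [LinearEquiv.ker_comp, hker]
  have hk0 : g.toLinearMap ∘ₗ k ≠ 0 := by
    intro h0
    rw [h0, LinearMap.ker_zero] at hker'
    obtain ⟨y, hy⟩ := exists_ne (0 : T.carrier)
    obtain ⟨x, rfl⟩ := hψs y
    exact hy (map_eq_zero_of_toCofree (hker'.le Submodule.mem_top))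
  refine Iso.quot_of_surjective (hk.comp hg) ((hk.comp hg).surjective_of_isSimple hS hk0) _ _ ?_
  rw [hker']
  -- The pullback of `p` is defined through `N/p`, the morphism to `S(T)` through `q/p ≅ T`. Since
  -- `q/p` embeds in `N/p` and tensoring with `C` preserves injectivity, the kernels agree.
  let ι : (N.subquot p q hp hq hpq).carrier →ₗ[K] N.carrier ⧸ p :=
    Submodule.mapQ (p.comap q.subtype) p q.subtype le_rfl
  have hι : Function.Injective ι :=
    LinearMap.ker_eq_bot.1 (Submodule.ker_liftQ_eq_bot _ _ _
      (by rw [LinearMap.ker_comp, Submodule.ker_mkQ]))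
  have hcomp : ι ∘ₗ π ∘ₗ φq = p.mkQ ∘ₗ φ ∘ₗ i := rfl
  ext x
  have h1 : A.toCofree (p.mkQ ∘ₗ φ ∘ₗ i) x = M.toCofree (p.mkQ ∘ₗ φ) (i x) :=
    LinearMap.congr_fun (hi.toCofree_comp (p.mkQ ∘ₗ φ)) x
  rw [LinearMap.mem_ker, Submodule.mem_comap]
  change _ ↔ M.toCofree (p.mkQ ∘ₗ φ) (i x) = 0
  rw [← h1, ← hcomp, toCofree_comp _ ι, toCofree_comp _ f.toLinearMap, LinearMap.comp_apply,
    LinearMap.comp_apply, map_eq_zero_iff _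
      (Module.Flat.rTensor_preserves_injective_linearMap (M := C) _ hι),
    map_eq_zero_iff _ (Module.Flat.rTensor_preserves_injective_linearMap (M := C) _ f.injective)]

/-- A composition series of `N` whose factors `T j` satisfy `S(T j) ≅ S j` with `S j` simple is
pulled back to a composition series of `M` with factors `S j`. -/
theorem IsLocalHom.exists_compSeries (hφ : IsLocalHom e M N φ) (hsurj : Function.Surjective φ)
    (hinj : Function.Injective (M.toCofree φ)) (s : N.CompSeries)
    {ι : Type*} {T : ι → RightComodule K e.Corner} {S : ι → RightComodule K C}
    (hS : ∀ i, (S i).IsSimple)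
    (h : ∀ j, ∃ i, (s.factor j).Iso (T i) ∧ (section_ e (T i)).Iso (S i)) :
    ∃ (s' : M.CompSeries) (σ : Fin s'.n ≃ Fin s.n), ∀ j i, (s.factor (σ j)).Iso (T i) →
      (section_ e (T i)).Iso (S i) → (s'.factor j).Iso (S i) := by
  have key : ∀ j i, (s.factor j).Iso (T i) → (section_ e (T i)).Iso (S i) →
      (M.subquot (pullback φ (s.F j.castSucc)) (pullback φ (s.F j.succ))
        (isSub_pullback φ _) (isSub_pullback φ _) (pullback_mono φ (s.le j))).Iso (S i) :=
    fun j i h1 h2 => hφ.subquot_pullback_iso hsurj (s.isSub _) (s.isSub _) (s.le j) (s.simple j)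
      h1 (hS i) h2
  -- No step of the series collapses, so the length is unchanged and the factors match index by
  -- index.
  refine ⟨⟨s.n, fun j => pullback φ (s.F j), fun j => isSub_pullback φ _, ?_, ?_,
    fun j => pullback_mono φ (s.le j), fun j => ?_⟩, Equiv.refl _, key⟩
  · rw [s.zero, pullback_bot hinj]
  · rw [s.last, pullback_top]
  · obtain ⟨i, h1, h2⟩ := h j
    exact (hS i).of_iso (key j i h1 h2).symm

end Filtration

end RightComodule

namespace Bimodule

/-! ### Localization of bimodules and its compatibility with specialization -/

section Localize

variable {R K C : Type u} [CommRing R] [Field K] [Algebra K R] [AddCommGroup C] [Module K C]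
  [Coalgebra K C]

/-- The action of `f ∈ C*` on an `R`-`C`-bimodule, as an `R`-linear map. -/
noncomputable def actR (L : Bimodule R K C) (f : C →ₗ[K] K) : L.carrier →ₗ[R] L.carrier where
  toFun := L.act f
  map_add' := map_add _
  map_smul' r x := by
    have h : ∀ t : L.carrier ⊗[K] C, TensorProduct.rid K L.carrier (f.lTensor L.carrier (r • t)) =
        r • TensorProduct.rid K L.carrier (f.lTensor L.carrier t) := by
      intro t
      induction t using TensorProduct.induction_on with
      | zero => simp
      | add a b ha hb => simp only [smul_add, map_add, ha, hb]
      | tmul a c =>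
        rw [TensorProduct.smul_tmul', LinearMap.lTensor_tmul, LinearMap.lTensor_tmul,
          TensorProduct.rid_tmul, TensorProduct.rid_tmul, smul_comm]
    change TensorProduct.rid K L.carrier (f.lTensor L.carrier (L.coact (r • x))) = _
    rw [L.coact_smul, h]
    rfl

/-- The `R`-submodule `eL` of `L`. -/
noncomputable def localSubmodule (L : Bimodule R K C) (e : DualIdempotent K C) :
    Submodule R L.carrier :=
  LinearMap.range (L.actR e.1.ofConv)

noncomputable instance instModuleLocalSpace (L : Bimodule R K C) (e : DualIdempotent K C) :
    Module R (L.localSpace e) :=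
  inferInstanceAs (Module R (L.localSubmodule e))

instance instIsScalarTowerLocalSpace (L : Bimodule R K C) (e : DualIdempotent K C) :
    IsScalarTower K R (L.localSpace e) :=
  ⟨fun a r x => Subtype.ext (smul_assoc a r (x : L.carrier))⟩

/-- The surjection `L → eL` as an `R`-linear map. -/
noncomputable def toLocalR (L : Bimodule R K C) (e : DualIdempotent K C) :
    L.carrier →ₗ[R] L.localSpace e where
  toFun := L.toLocal e
  map_add' := map_add _
  map_smul' r x := Subtype.ext ((L.actR e.1.ofConv).map_smul r x)

/-- The inclusion `eL → L` as an `R`-linear map. -/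
noncomputable def localInclR (L : Bimodule R K C) (e : DualIdempotent K C) :
    L.localSpace e →ₗ[R] L.carrier where
  toFun x := x
  map_add' _ _ := rfl
  map_smul' _ _ := rfl

/-- The `R`-`eCe`-bimodule `eL`. -/
noncomputable def localize (e : DualIdempotent K C) (L : Bimodule R K C) :
    Bimodule R K e.Corner where
  toRightComodule := L.toRightComodule.localize e
  moduleR := L.instModuleLocalSpace e
  isScalarTower := L.instIsScalarTowerLocalSpace e
  coact_smul r x := by
    have h : ∀ t : L.carrier ⊗[K] C, TensorProduct.map (L.toLocal e) e.toCorner (r • t) =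
        r • TensorProduct.map (L.toLocal e) e.toCorner t := by
      intro t
      induction t using TensorProduct.induction_on with
      | zero => simp
      | add a b ha hb => simp only [smul_add, map_add, ha, hb]
      | tmul a c =>
        rw [TensorProduct.smul_tmul', TensorProduct.map_tmul, TensorProduct.map_tmul,
          TensorProduct.smul_tmul']
        congr 1
        exact (L.toLocalR e).map_smul r a
    change TensorProduct.map (L.toLocal e) e.toCorner (L.coact (r • L.localInclR e x)) = _
    rw [L.coact_smul, h]
    rfl

theorem localize_finite (e : DualIdempotent K C) (L : Bimodule R K C)
    [Module.Finite R L.carrier] : Module.Finite R (L.localize e).carrier :=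
  Module.Finite.of_surjective (L.toLocalR e) (LinearMap.surjective_rangeRestrict _)

/-- `eL` is an `R`-submodule of a free module over a principal ideal domain. -/
theorem localize_free [IsDomain R] [IsPrincipalIdealRing R] (e : DualIdempotent K C)
    (L : Bimodule R K C) [Module.Finite R L.carrier] [Module.Free R L.carrier] :
    Module.Free R (L.localize e).carrier :=
  inferInstanceAs (Module.Free R (L.localSubmodule e))

theorem tensor_act (V : Type u) [AddCommGroup V] [Module R V] [Module K V] [IsScalarTower K R V]
    (L : Bimodule R K C) (f : C →ₗ[K] K) (t : V ⊗[R] L.carrier) :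
    (L.tensor V).act f t = (L.actR f).lTensor V t := by
  change TensorProduct.rid K (V ⊗[R] L.carrier) (f.lTensor (V ⊗[R] L.carrier)
    ((TensorProduct.AlgebraTensorModule.assoc K R R V L.carrier C).symm
      (L.coactR.lTensor V t))) = _
  induction t using TensorProduct.induction_on with
  | zero => simp
  | add a b ha hb => simp only [map_add, ha, hb]
  | tmul v m =>
    change TensorProduct.rid K (V ⊗[R] L.carrier) (f.lTensor (V ⊗[R] L.carrier)
      ((TensorProduct.AlgebraTensorModule.assoc K R R V L.carrier C).symm (v ⊗ₜ L.coact m))) =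
      v ⊗ₜ (TensorProduct.rid K L.carrier (f.lTensor L.carrier (L.coact m)))
    induction L.coact m using TensorProduct.induction_on with
    | zero => simp
    | add a b ha hb => simp only [TensorProduct.tmul_add, map_add, ha, hb]
    | tmul a c => simp

/-- The map `V ⊗ L → V ⊗ eL` induced by `x ↦ ex` is a surjective local morphism, and `e` kills its
kernel. -/
theorem tensor_localize_iso (V : Type u) [AddCommGroup V] [Module R V] [Module K V]
    [IsScalarTower K R V] (e : DualIdempotent K C) (L : Bimodule R K C) :
    ((L.tensor V).localize e).Iso ((L.localize e).tensor V) := by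
  let q : L.carrier →ₗ[R] (L.localize e).carrier := L.toLocalR e
  let φ : V ⊗[R] L.carrier →ₗ[K] V ⊗[R] (L.localize e).carrier :=
    (q.lTensor V).restrictScalars K
  have key : ∀ t : V ⊗[R] L.carrier, TensorProduct.map φ e.toCorner
      ((TensorProduct.AlgebraTensorModule.assoc K R R V L.carrier C).symm
        (L.coactR.lTensor V t)) =
      (TensorProduct.AlgebraTensorModule.assoc K R R V (L.localize e).carrier e.Corner).symm
        ((L.localize e).coactR.lTensor V (φ t)) := by
    intro t
    induction t using TensorProduct.induction_on with
    | zero => simp only [map_zero]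
    | add a b ha hb => simp only [map_add, ha, hb]
    | tmul v m =>
      have h := (RightComodule.toLocal_isLocalHom e L.toRightComodule).apply m
      change TensorProduct.map φ e.toCorner
        ((TensorProduct.AlgebraTensorModule.assoc K R R V L.carrier C).symm (v ⊗ₜ L.coact m)) =
        (TensorProduct.AlgebraTensorModule.assoc K R R V (L.localize e).carrier e.Corner).symm
          (v ⊗ₜ (L.localize e).coact (L.toLocal e m))
      refine Eq.trans ?_ (congrArg (fun t => (TensorProduct.AlgebraTensorModule.assoc K R R V
        (L.localize e).carrier e.Corner).symm (v ⊗ₜ t)) h)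
      have hq : ∀ s : L.carrier ⊗[K] C, TensorProduct.map φ e.toCorner
          ((TensorProduct.AlgebraTensorModule.assoc K R R V L.carrier C).symm (v ⊗ₜ s)) =
          (TensorProduct.AlgebraTensorModule.assoc K R R V (L.localize e).carrier e.Corner).symm
            (v ⊗ₜ TensorProduct.map (q.restrictScalars K) e.toCorner s) := by
        intro s
        induction s using TensorProduct.induction_on with
        | zero => simp only [TensorProduct.tmul_zero, map_zero]
        | add a b ha hb => simp only [TensorProduct.tmul_add, map_add, ha, hb]
        | tmul a c => rfl
      exact hq _
  have hφ : RightComodule.IsLocalHom e (L.tensor V) ((L.localize e).tensor V) φ :=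
    LinearMap.ext key
  refine hφ.localize_iso (LinearMap.lTensor_surjective V (LinearMap.surjective_rangeRestrict _))
    fun t ht => ?_
  -- On `V ⊗ L`, `e` acts through `V ⊗ eL`, so whatever dies there is killed by `e`; injectivity of
  -- `V ⊗ eL → V ⊗ L` is not needed.
  have h : L.actR e.1.ofConv = L.localInclR e ∘ₗ q := rfl
  refine (L.tensor_act V e.1.ofConv t).trans ?_
  rw [h]
  refine (LinearMap.lTensor_comp_apply V (L.localInclR e) q _).trans ?_
  exact (congrArg _ ht).trans (map_zero _)

end Localize

end Bimodule

/-! ### Simple comodules of `C` and `eCe`, length vectors and the conclusion -/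

section Basic

variable {K C : Type u} [Field K] [AddCommGroup C] [Module K C] [Coalgebra K C]

/-- A functional `f` on a comodule `M` gives a morphism `h : M → C`, `x ↦ ∑ f(x₀) x₁`, with
`ε ∘ h = f`. -/
theorem RightComodule.exists_isHom_regular (M : RightComodule K C) (f : M.carrier →ₗ[K] K) :
    ∃ h : M.carrier →ₗ[K] C, IsHom M (regular K C) h ∧ counit ∘ₗ h = f := by
  have hlid : IsHom (tensorLeft K (regular K C)) (regular K C)
      (TensorProduct.lid K C).toLinearMap := by
    refine TensorProduct.ext' fun a c => ?_
    change (TensorProduct.lid K C).toLinearMap.rTensor C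
      ((TensorProduct.assoc K K C C).symm (a ⊗ₜ comul c)) = comul (TensorProduct.lid K C (a ⊗ₜ c))
    rw [TensorProduct.lid_tmul, map_smul]
    induction comul (R := K) c using TensorProduct.induction_on with
    | zero => simp
    | add a b ha hb => simp only [TensorProduct.tmul_add, map_add, ha, hb, smul_add]
    | tmul b c => simp [TensorProduct.smul_tmul']
  refine ⟨(TensorProduct.lid K C).toLinearMap ∘ₗ M.toCofree f, (toCofree_isHom f).comp hlid, ?_⟩
  ext x
  have h1 : ∀ t : K ⊗[K] C, counit (R := K) (TensorProduct.lid K C t) =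
      TensorProduct.lid K K ((counit (R := K) (A := C)).lTensor K t) := by
    intro t
    induction t using TensorProduct.induction_on with
    | zero => simp
    | add a b ha hb => simp only [map_add, ha, hb]
    | tmul a c => simp
  refine (h1 _).trans ?_
  rw [lTensor_counit_toCofree]
  simp

namespace IsBasicWith

open RightComodule

variable {I : Type*} {S : I → Submodule K C}

/-- The inclusion of the simple comodule `S i` in `C`. -/
noncomputable def incl (h : IsBasicWith S) (i : I) : (h.simples i).carrier →ₗ[K] C :=
  (regular K C).subIncl (S i) (h.isSub i)

theorem incl_isHom (h : IsBasicWith S) (i : I) :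
    IsHom (h.simples i) (regular K C) (h.incl i) :=
  subIncl_isHom _ _ _

theorem range_incl (h : IsBasicWith S) (i : I) : LinearMap.range (h.incl i) = S i :=
  range_subIncl _ _ _

theorem simples_isSimple (h : IsBasicWith S) (i : I) : (h.simples i).IsSimple :=
  h.simple i

/-- The image of a nonzero morphism from a simple comodule is a simple subcomodule of `C`, hence
part of the socle. -/
theorem range_le_of_isSimple (h : IsBasicWith S) {M : RightComodule K C} (hM : M.IsSimple)
    {f : M.carrier →ₗ[K] C} (hf : IsHom M (regular K C) f) :
    LinearMap.range f ≤ ⨆ i, LinearMap.range (h.incl i) := by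
  by_cases h0 : f = 0
  · rw [h0, LinearMap.range_zero]
    exact bot_le
  simp only [range_incl]
  rw [h.iSup_eq]
  refine le_sSup ⟨isSub_range hf, ?_⟩
  obtain ⟨k, hk, hkf⟩ := hf.exists_lift (subIncl_isHom _ _ (isSub_range hf))
    (subIncl_injective _ _ _) (range_subIncl _ _ _).ge
  refine hM.of_iso (Iso.of_bijective hk ⟨?_, ?_⟩)
  · refine hk.injective_of_isSimple hM fun hk0 => h0 ?_
    rw [← hkf, hk0, LinearMap.comp_zero]
  · intro y
    obtain ⟨x, hx⟩ := Subtype.property (p := (· ∈ LinearMap.range f)) y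
    exact ⟨x, subIncl_injective _ _ (isSub_range hf) ((LinearMap.congr_fun hkf x).trans hx)⟩

/-- A functional that is nonzero on `M` yields a nonzero morphism `M → C`, with image in the socle.
-/
theorem exists_iso_simples (h : IsBasicWith S) {M : RightComodule K C} (hM : M.IsSimple) :
    ∃ i, M.Iso (h.simples i) := by
  have := hM.1
  obtain ⟨x, hx⟩ := exists_ne (0 : M.carrier)
  obtain ⟨f, hf⟩ : ∃ f : M.carrier →ₗ[K] K, f x ≠ 0 := by
    by_contra! hf
    exact hx ((Module.forall_dual_apply_eq_zero_iff K x).1 hf)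
  obtain ⟨g, hg, hgf⟩ := M.exists_isHom_regular f
  refine hM.exists_iso_of_range_le h.simples_isSimple h.incl_isHom hg ?_
    (h.range_le_of_isSimple hM hg)
  rintro rfl
  rw [← hgf] at hf
  simp at hf

/-- Each simple occurs only once in the socle: modulo `S i`, the image of `f` lies in the sum of the
images of the `S j` with `j ≠ i`, so if it were nonzero then `S i ≅ S j` for such a `j`. -/
theorem range_le_of_isHom (h : IsBasicWith S) {i : I} {f : (h.simples i).carrier →ₗ[K] C}
    (hf : IsHom (h.simples i) (regular K C) f) : LinearMap.range f ≤ S i := by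
  let q := (regular K C).quotMk (S i) (h.isSub i)
  have hq : IsHom (regular K C) _ q := quotMk_isHom _ _ _
  have hqk : LinearMap.ker q = S i := ker_quotMk _ _ _
  by_contra hle
  have h0 : q ∘ₗ f ≠ 0 := fun h0 => hle <| by
    rw [← hqk]
    rintro _ ⟨x, rfl⟩
    exact LinearMap.congr_fun h0 x
  obtain ⟨j, hj⟩ := (h.simples_isSimple i).exists_iso_of_range_le
    (S := fun j : {j // i ≠ j} => h.simples j) (fun j => h.simples_isSimple j)
    (g := fun j => q ∘ₗ h.incl j) (fun j => (h.incl_isHom j).comp hq) (hf.comp hq) h0 (by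
      rw [LinearMap.range_comp]
      refine (Submodule.map_mono (h.range_le_of_isSimple (h.simples_isSimple i) hf)).trans ?_
      rw [Submodule.map_iSup]
      refine iSup_le fun j => ?_
      rw [← LinearMap.range_comp]
      by_cases hij : i = j
      · subst hij
        rintro _ ⟨x, rfl⟩
        have hx : q (h.incl i x) = 0 := LinearMap.mem_ker.1 <| by
          rw [hqk, ← h.range_incl i]
          exact ⟨x, rfl⟩
        rw [LinearMap.comp_apply, hx]
        exact zero_mem _
      · exact le_iSup (fun j : {j // i ≠ j} => LinearMap.range (q ∘ₗ h.incl j)) ⟨j, hij⟩)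
  exact h.not_iso i j j.2 hj

/-- Functionals on `S i` come from morphisms `S i → C`. These land in `S i`, so they are
endomorphisms of `S i`, which are scalars by Schur's lemma over an algebraically closed field. Hence
the dual of `S i` is spanned by the restriction of the counit. -/
theorem finrank_simples [IsAlgClosed K] (h : IsBasicWith S) (i : I) :
    Module.finrank K (h.simples i).carrier = 1 := by
  have hfd := (h.simples_isSimple i).finiteDimensional
  have hnt := (h.simples_isSimple i).1
  refine le_antisymm ?_ Module.finrank_pos
  rw [← Subspace.dual_finrank_eq]
  refine finrank_le_one (counit ∘ₗ h.incl i : (h.simples i).carrier →ₗ[K] K) fun f => ?_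
  obtain ⟨g, hg, hgf⟩ := (h.simples i).exists_isHom_regular f
  have hr : LinearMap.range g ≤ LinearMap.range (h.incl i) := by
    rw [range_incl]
    exact h.range_le_of_isHom hg
  obtain ⟨k, hk, hkg⟩ := hg.exists_lift (h.incl_isHom i) (subIncl_injective _ _ _) hr
  obtain ⟨c, hc⟩ := Module.End.exists_eigenvalue k
  have hhom := hk.sub (IsHom.smul_id (h.simples i) c)
  have hk' : k = c • LinearMap.id := by
    by_contra hne
    have hinj := hhom.injective_of_isSimple (h.simples_isSimple i) (sub_ne_zero.2 hne)
    obtain ⟨x, hx, hx0⟩ := hc.exists_hasEigenvector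
    apply hx0
    apply hinj
    rw [map_zero, LinearMap.sub_apply, Module.End.mem_eigenspace_iff.1 hx]
    simp
  refine ⟨c, ?_⟩
  rw [← hgf, ← hkg, hk', LinearMap.comp_smul, LinearMap.comp_smul, LinearMap.comp_id]

/-- Every simple right `eCe`-comodule is isomorphic to `e S i` for some `i ∈ I_e`. -/
theorem exists_iso_localSimples [IsAlgClosed K] (h : IsBasicWith S) (e : DualIdempotent K C)
    {T : RightComodule K e.Corner} (hT : T.IsSimple) :
    ∃ i, T.Iso (h.localSimples e i) := by
  obtain ⟨φ, hφ, hsurj, hinj⟩ := exists_isLocalHom_section T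
  have := hT.1
  have := hsurj.nontrivial
  obtain ⟨p, hp, hps⟩ := exists_isSimple_sub (section_ e T)
  obtain ⟨i, hi⟩ := h.exists_iso_simples hps
  obtain ⟨g, hg⟩ := hi.symm
  -- The counit `S(T) → T` restricted to a simple subcomodule of `S(T)`, identified with some `S i`.
  let ψ : (h.simples i).carrier →ₗ[K] T.carrier :=
    φ ∘ₗ (section_ e T).subIncl p hp ∘ₗ g.toLinearMap
  have hψ : IsLocalHom e (h.simples i) T ψ := hφ.comp_isHom (hg.comp (subIncl_isHom _ _ _))
  have hψ0 : ψ ≠ 0 := by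
    intro h0
    have hbot : p = ⊥ := eq_bot_of_forall_map_eq_zero hinj hp fun x hx => by
      obtain ⟨y, hy⟩ := g.surjective (⟨x, hx⟩ : p)
      have hyx : (section_ e T).subIncl p hp (g y) = x := congrArg _ hy
      rw [← hyx]
      exact LinearMap.congr_fun h0 y
    exact Submodule.nontrivial_iff_ne_bot.1 hps.1 hbot
  -- Because `S i` is one-dimensional, the nonzero map `ψ` is injective as a linear map. Then `ψ(ex)
  -- = ψ x` forces `ex = x`, so `i ∈ I_e`.
  have hsm : IsSimpleModule K (h.simples i).carrier :=
    isSimpleModule_iff_finrank_eq_one.2 (h.finrank_simples i)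
  have hψi : Function.Injective ψ := ψ.injective_of_ne_zero hψ0
  have hψs : Function.Surjective ψ := by
    have hsub : T.IsSub (Submodule.map ψ ⊤) :=
      hψ.isSub_map (isSub_top _)
    rw [Submodule.map_top] at hsub
    rcases hT.2 _ hsub with h' | h'
    · exact absurd (LinearMap.range_eq_bot.1 h') hψ0
    · exact LinearMap.range_eq_top.1 h'
  have htop : (h.simples i).localSpace e = ⊤ :=
    eq_top_iff.2 fun x _ => ⟨x, hψi (hψ.map_act x)⟩
  refine ⟨⟨i, htop⟩, (hψ.localize_iso hψs fun x hx => ?_).symm⟩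
  rw [hψi (hx.trans (map_zero ψ).symm), map_zero]

/-- The pulled-back series has a factor `S i` exactly where the series of `N` has `eS i`, and no
factor outside `I_e`. -/
theorem hasLengthVector_section [IsAlgClosed K] (h : IsBasicWith S) (e : DualIdempotent K C)
    {v : h.localIndex e →₀ ℤ}
    (hv : ∀ i, v i ≠ 0 → (section_ e (h.localSimples e i)).Iso (h.simples i))
    {N : RightComodule K e.Corner} (hN : N.HasLengthVector (h.localSimples e) v) :
    (section_ e N).HasLengthVector h.simples (extendByZero v) := by
  obtain ⟨-, s, hs⟩ := hN
  obtain ⟨φ, hφ, hsurj, hinj⟩ := exists_isLocalHom_section N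
  have hsec : ∀ j i, (s.factor j).Iso (h.localSimples e i) →
      (section_ e (h.localSimples e i)).Iso (h.simples i) := by
    intro j i hj
    refine hv i ?_
    -- A simple that occurs as a factor has positive multiplicity, which is what makes the
    -- hypothesis on `S(eS_i)` applicable to it.
    have : Nonempty {j : Fin s.n // (s.factor j).Iso (h.localSimples e i)} := ⟨⟨j, hj⟩⟩
    rw [hs i]
    exact_mod_cast Nat.card_pos.ne'
  have hex : ∀ j, ∃ i, (s.factor j).Iso (h.localSimples e i) := fun j =>
    h.exists_iso_localSimples e (s.simple j)
  obtain ⟨s', σ, key⟩ := hφ.exists_compSeries hsurj hinj s (T := h.localSimples e)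
    (S := fun i : h.localIndex e => h.simples i) (fun i => h.simples_isSimple i)
    fun j => (hex j).imp fun i hi => ⟨hi, hsec j i hi⟩
  refine ⟨s'.finiteDimensional, s', fun i => ?_⟩
  have hfac : ∀ j, (s'.factor j).Iso (h.simples i) →
      ∃ hi : i ∈ h.localIndex e, (s.factor (σ j)).Iso (h.localSimples e ⟨i, hi⟩) := by
    intro j hj
    obtain ⟨i', hi'⟩ := hex (σ j)
    -- The type of the pulled-back factor determines the index, since the `S i` are pairwise
    -- non-isomorphic.
    have heq : i = i' := by
      by_contra hne
      exact h.not_iso _ _ hne (hj.symm.trans (key j i' hi' (hsec _ _ hi')))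
    subst heq
    exact ⟨i'.2, hi'⟩
  by_cases hi : i ∈ h.localIndex e
  · have h1 : extendByZero v i = v ⟨i, hi⟩ :=
      Finsupp.mapDomain_apply Subtype.val_injective v ⟨i, hi⟩
    rw [h1, hs]
    refine congrArg _ (Nat.card_congr (σ.subtypeEquiv fun j => ?_)).symm
    exact ⟨fun hj => (hfac j hj).2, fun hj => key j _ hj (hsec _ _ hj)⟩
  · have h1 : extendByZero v i = 0 := Finsupp.mapDomain_of_notMem_range v i (by simpa using hi)
    have : IsEmpty {j : Fin s'.n // (s'.factor j).Iso (h.simples i)} :=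
      ⟨fun j => hi (hfac j.1 j.2).1⟩
    rw [h1, Nat.card_of_isEmpty, Nat.cast_zero]

/-- The family `L` for `C` parametrizes almost all comodules `S(N)`; applying `e` and using `eS(N) ≅
N`, the family `eL` parametrizes almost all `N`, with exceptions among the `e(E j)`. -/
theorem isAlmostParametrizing_localize [IsAlgClosed K] (h : IsBasicWith S)
    (e : DualIdempotent K C) {v : h.localIndex e →₀ ℤ}
    (hv : ∀ i, v i ≠ 0 → (section_ e (h.localSimples e i)).Iso (h.simples i)) {r : ℕ}
    {L : Fin r → Bimodule K[X] K C}
    (hL : IsAlmostParametrizing h.simples (extendByZero v) L) :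
    IsAlmostParametrizing (h.localSimples e) v fun s => (L s).localize e := by
  obtain ⟨hfree, m, E, hE⟩ := hL
  refine ⟨fun s => ?_, m, fun j => (E j).localize e, fun N hN hNv => ?_⟩
  · have := (hfree s).1
    have := (hfree s).2
    exact ⟨(L s).localize_finite e, (L s).localize_free e⟩
  · obtain ⟨φ, hφ, hsurj, hinj⟩ := exists_isLocalHom_section N
    have hiso : N.Iso ((section_ e N).localize e) :=
      (hφ.localize_iso hsurj fun _ hx => hφ.act_eq_zero hinj hx).symm
    rcases hE _ (hφ.isIndecomposable hsurj hinj hN) (h.hasLengthVector_section e hv hNv) with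
      ⟨j, hj⟩ | ⟨s, lam, hs⟩
    · exact Or.inl ⟨j, hiso.trans (hj.localize e)⟩
    · exact Or.inr ⟨s, lam, (hiso.trans (hs.localize e)).trans
        (Bimodule.tensor_localize_iso _ e (L s))⟩

end IsBasicWith

end Basic

theorem mainTheorem8 {K C : Type u} [Field K] [IsAlgClosed K] [AddCommGroup C] [Module K C]
    [Coalgebra K C] {I : Type*} (S : I → Submodule K C) (hC : IsBasicWith S)
    (e : DualIdempotent K C) (v : hC.localIndex e →₀ ℤ)
    (hv : ∀ i, v i ≠ 0 → (RightComodule.section_ e (hC.localSimples e i)).Iso (hC.simples i))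
    (htame : TamenessCondition hC.simples (extendByZero v)) :
    TamenessCondition (hC.localSimples e) v ∧
      growthFunction (hC.localSimples e) v ≤ growthFunction hC.simples (extendByZero v) := by
  have key : ∀ r, (∃ L : Fin r → Bimodule K[X] K C,
      IsAlmostParametrizing hC.simples (extendByZero v) L) →
      ∃ L : Fin r → Bimodule K[X] K e.Corner, IsAlmostParametrizing (hC.localSimples e) v L :=
    fun r ⟨_, hL⟩ => ⟨_, hC.isAlmostParametrizing_localize e hv hL⟩
  -- An infimum over the empty set would be `0`; tameness of `C` makes its set of admissible `r`
  -- nonempty, so the infimum is attained and can be transferred to `eCe`.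
  exact ⟨htame.imp key, Nat.sInf_le (key _ (Nat.sInf_mem htame))⟩
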